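/- In the weighted $k$-server problem on the uniform metric on $n$ points, an instance $\mathcal I$ has $\ell\ge 1$ weight classes with distinct nonnegative rational weights $W_1,\dots,W_\ell$, and $k_j\ge 1$ servers of weight $W_j$ with given initial positions, for each $j\in[\ell]$; requests $\sigma_1,\dots,\sigma_T$ (points) arrive online, and after the arrival of $\sigma_t$ some server must be at $\sigma_t$. The cost of a solution is $\frac12$ times the total weight of the server moves (a move of a server between two distinct points counts with the weight of the server), and $\mathrm{OPT}$ is the minimum cost of an offline solution that uses $k_j$ servers of weight $W_j$ for each $j$. There are a randomized online algorithm (one algorithm for all instances) and an absolute constant $C$ such that, on every instance $\mathcal I$ and every request sequence $\sigma$ (fixed independently of the coins of the algorithm), the algorithm uses $2\ell k_j$ servers of weight $W_j$ for each $j\in[\ell]$ (each server of $\mathcal I$ being replaced by $2\ell$ servers with the same weight and initial position), serves every request for every outcome of its coins, runs in total time polynomial in the bit length of $\mathcal I$ and $\sigma$ for every outcome of its coins, and has expected cost at most $$C\,\ell^2\log(\ell+1)\cdot \mathrm{OPT}(\mathcal I,\sigma).$$ That is, its expected cost is $O(\ell^2\log\ell)\cdot\mathrm{OPT}$ for $\ell\ge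 2$, and $O(1)\cdot\mathrm{OPT}$ for $\ell=1$. -/

import Mathlib

open scoped NNRat ENNReal

namespace WeightedKServer

/-! ### The weighted k-server problem on the uniform metric -/

/-- An instance (without its request sequence) of weighted `k`-server on the uniform metric on the
`n` points of `Fin n`: there are `ℓ ≥ 1` weight classes with pairwise distinct weights
`W j ≥ 0` (rational, so that an algorithm can read them), class `j` has `k j ≥ 1` servers, and
`init j i` is the position at time `0` of the `i`-th server of class `j`. -/
structure Instance where
  n : ℕ
  ℓ : ℕ
  W : Fin ℓ → ℚ≥0
  k : Fin ℓ → ℕ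
  init : (j : Fin ℓ) → Fin (k j) → Fin n
  ℓ_pos : 0 < ℓ
  k_pos : ∀ j, 0 < k j
  W_injective : Function.Injective W

namespace Instance

variable (I : Instance)

/-- The positions of all servers, if class `j` has `m j` servers. -/
abbrev Config (m : Fin I.ℓ → ℕ) : Type := (j : Fin I.ℓ) → Fin (m j) → Fin I.n

/-- `f` starts in the configuration `start` and has, for each time `t`, a server on the point
requested at time `t`. The `t`-th request (`t : Fin T`) is served by the configuration
`f t.succ`. -/
def IsSolution {m : Fin I.ℓ → ℕ} (start : I.Config m) {T : ℕ} (σ : Fin T → Fin I.n)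
    (f : Fin (T + 1) → I.Config m) : Prop :=
  f 0 = start ∧ ∀ t : Fin T, ∃ (j : Fin I.ℓ) (s : Fin (m j)), f t.succ j s = σ t

/-- The weighted movement cost, with the normalizing factor `1/2`. -/
noncomputable def cost {m : Fin I.ℓ → ℕ} {T : ℕ} (f : Fin (T + 1) → I.Config m) : ℝ :=
  (1 / 2) * ∑ j : Fin I.ℓ, (I.W j : ℝ) *
    ∑ s : Fin (m j), ∑ t : Fin T, if f t.succ j s ≠ f t.castSucc j s then 1 else 0

/-- The optimal (offline) cost, with `k j` servers in class `j`. -/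
noncomputable def opt {T : ℕ} (σ : Fin T → Fin I.n) : ℝ :=
  sInf {c | ∃ f : Fin (T + 1) → I.Config I.k, I.IsSolution I.init σ f ∧ c = I.cost f}

/-- The infimum in the definition of `opt` is a minimum. -/
theorem isLeast_opt {T : ℕ} (σ : Fin T → Fin I.n) :
    IsLeast {c | ∃ f : Fin (T + 1) → I.Config I.k, I.IsSolution I.init σ f ∧ c = I.cost f}
      (I.opt σ) := by
  have hfin : {c | ∃ f : Fin (T + 1) → I.Config I.k,
      I.IsSolution I.init σ f ∧ c = I.cost f}.Finite :=
    (Set.finite_range (fun f : Fin (T + 1) → I.Config I.k => I.cost f)).subset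
      (by rintro c ⟨f, -, rfl⟩; exact ⟨f, rfl⟩)
  have hne : {c | ∃ f : Fin (T + 1) → I.Config I.k,
      I.IsSolution I.init σ f ∧ c = I.cost f}.Nonempty := by
    refine ⟨_, Fin.cases I.init (fun t => fun _ _ => σ t), ⟨rfl, fun t => ?_⟩, rfl⟩
    exact ⟨⟨0, I.ℓ_pos⟩, ⟨0, I.k_pos _⟩, rfl⟩
  exact ⟨hne.csInf_mem hfin, fun c hc => csInf_le hfin.bddBelow hc⟩

/-- The number of servers of class `j` with `2ℓ`-resource augmentation. -/
def augCount (j : Fin I.ℓ) : ℕ := 2 * I.ℓ * I.k j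

/-- Each server of the instance is replaced by `2ℓ` servers at the same initial position. -/
def augInit : I.Config I.augCount :=
  fun j s => I.init j ⟨s.val % I.k j, Nat.mod_lt _ (I.k_pos j)⟩

end Instance

/-! ### Randomized programs with logarithmic cost -/

/-- The names of the arrays of a program: those through which it communicates, and work arrays. -/
inductive Arr
  | points
  | classes
  | count
  | num
  | den
  | start
  | request
  | position
  | work (i : ℕ)
  deriving DecidableEq

/-- The memory: two-dimensional arrays of natural numbers. A scalar is the entry `(0, 0)` of an
array. -/
abbrev Mem : Type := Arr → ℕ → ℕ → ℕ

/-- Write `v` into the entry `(i, j)` of the array `a`. -/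
def Mem.write (M : Mem) (a : Arr) (i j v : ℕ) : Mem :=
  fun a' i' j' => if a' = a ∧ i' = i ∧ j' = j then v else M a' i' j'

/-- The space that a number takes: its number of binary digits, and a separator. -/
def bits (x : ℕ) : ℕ := Nat.size x + 1

/-- Arithmetic expressions. -/
inductive Expr
  | lit (c : ℕ)
  | get (a : Arr) (i j : Expr)
  | add (x y : Expr)
  | sub (x y : Expr)
  | mul (x y : Expr)
  | div (x y : Expr)
  | eq (x y : Expr)
  | lt (x y : Expr)
  | len (x : Expr)

/-- The value of an expression. Subtraction is truncated, `div` is the integer quotient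
(`0` for the divisor `0`), `eq` and `lt` return `1` for true and `0` for false, and `len` is the
number of binary digits. -/
def Expr.eval (M : Mem) : Expr → ℕ
  | lit c => c
  | get a i j => M a (i.eval M) (j.eval M)
  | add x y => x.eval M + y.eval M
  | sub x y => x.eval M - y.eval M
  | mul x y => x.eval M * y.eval M
  | div x y => x.eval M / y.eval M
  | eq x y => if x.eval M = y.eval M then 1 else 0
  | lt x y => if x.eval M < y.eval M then 1 else 0
  | len x => Nat.size (x.eval M)

/-- The time for evaluating an expression (logarithmic cost): the bit length of each number that
occurs in the evaluation, array indices and intermediate results included. -/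
def Expr.cost (M : Mem) : Expr → ℕ
  | lit c => bits c
  | get a i j => i.cost M + j.cost M + bits ((get a i j).eval M)
  | add x y => x.cost M + y.cost M + bits ((add x y).eval M)
  | sub x y => x.cost M + y.cost M + bits ((sub x y).eval M)
  | mul x y => x.cost M + y.cost M + bits ((mul x y).eval M)
  | div x y => x.cost M + y.cost M + bits ((div x y).eval M)
  | eq x y => x.cost M + y.cost M + bits ((eq x y).eval M)
  | lt x y => x.cost M + y.cost M + bits ((lt x y).eval M)
  | len x => x.cost M + bits ((len x).eval M)

/-- Programs of a random access machine: assignment to an array entry, tossing a fair coin,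
composition, branching, and repetition (the number of rounds is computed on entry, so each
program halts). These are special programs of a random access machine with unrestricted jumps, so
the existence of such a program is at least as strong as the existence of a program there. -/
inductive Prog
  | skip
  | set (a : Arr) (i j e : Expr)
  | flip (a : Arr) (i j : Expr)
  | seq (p q : Prog)
  | ite (e : Expr) (p q : Prog)
  | loop (e : Expr) (p : Prog)

/-- The memory and the time used so far. -/
structure State where
  mem : Mem
  time : ℕ

/-- Let `d` units of time pass. -/
def State.tick (s : State) (d : ℕ) : State := ⟨s.mem, s.time + d⟩

/-- `N` rounds of `step`; each costs one unit of time on top of the time for `step`. -/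
noncomputable def rounds (step : State → PMF State) : ℕ → State → PMF State
  | 0, s => PMF.pure s
  | N + 1, s => (step (s.tick 1)).bind (rounds step N)

/-- The distribution of the state after the execution of a program. The coins are fair and
independent. -/
noncomputable def Prog.exec : Prog → State → PMF State
  | skip, s => PMF.pure (s.tick 1)
  | set a i j e, s =>
      PMF.pure ⟨s.mem.write a (i.eval s.mem) (j.eval s.mem) (e.eval s.mem),
        s.time + (i.cost s.mem + j.cost s.mem + e.cost s.mem + 1)⟩
  | flip a i j, s =>
      (PMF.uniformOfFintype Bool).map fun b =>
        ⟨s.mem.write a (i.eval s.mem) (j.eval s.mem) b.toNat,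
          s.time + (i.cost s.mem + j.cost s.mem + 1)⟩
  | seq p q, s => (p.exec s).bind q.exec
  | ite e p q, s =>
      if e.eval s.mem ≠ 0 then p.exec (s.tick (e.cost s.mem + 1))
      else q.exec (s.tick (e.cost s.mem + 1))
  | loop e p, s => rounds p.exec (e.eval s.mem) (s.tick (e.cost s.mem + 1))

/-! ### Randomized online algorithms for weighted k-server -/

/-- A randomized online algorithm: the program `setup` is run once on the instance, before any
request is known; the program `serve` is run at each request, on the memory left by the previous
run. -/
structure OnlineAlgorithm where
  setup : Prog
  serve : Prog

namespace Instance

variable (I : Instance)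

/-- The memory at the beginning holds the instance: the numbers `n`, `ℓ`, `k j`, the numerator and
the denominator of `W j`, and the initial positions. All other entries are `0`. -/
def inputMem : Mem
  | .points, i, j => if i = 0 ∧ j = 0 then I.n else 0
  | .classes, i, j => if i = 0 ∧ j = 0 then I.ℓ else 0
  | .count, i, j => if h : i < I.ℓ then (if j = 0 then I.k ⟨i, h⟩ else 0) else 0
  | .num, i, j => if h : i < I.ℓ then (if j = 0 then (I.W ⟨i, h⟩).num else 0) else 0
  | .den, i, j => if h : i < I.ℓ then (if j = 0 then (I.W ⟨i, h⟩).den else 0) else 0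
  | .start, i, j =>
      if h : i < I.ℓ then (if h' : j < I.k ⟨i, h⟩ then (I.init ⟨i, h⟩ ⟨j, h'⟩).val else 0) else 0
  | .request, _, _ => 0
  | .position, _, _ => 0
  | .work _, _, _ => 0

/-- The length in bits of the instance together with the request sequence. -/
def inputSize {T : ℕ} (σ : Fin T → Fin I.n) : ℕ :=
  bits I.n + bits I.ℓ +
    (∑ j : Fin I.ℓ, (bits (I.k j) + bits (I.W j).num + bits (I.W j).den +
      ∑ i : Fin (I.k j), bits (I.init j i).val)) +
    ∑ t : Fin T, bits (σ t).val

theorem n_pos : 0 < I.n := (I.init ⟨0, I.ℓ_pos⟩ ⟨0, I.k_pos _⟩).pos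

/-- The configuration of the `2ℓ * k j` servers of each class `j` that is written in the array
`position`. Entries are read modulo `n`, so that each number denotes a point. -/
def readConfig (M : Mem) : I.Config I.augCount :=
  fun j s => ⟨M .position j.val s.val % I.n, Nat.mod_lt _ I.n_pos⟩

end Instance

namespace OnlineAlgorithm

variable (A : OnlineAlgorithm) (I : Instance)

/-- The joint distribution of the final state of the machine and of the configurations at the times
`0, …, T`, when the requests `σ` arrive one by one: in the second
clause the last request is shown to the algorithm only after it has fixed the configurations at the
times `0, …, T`, and the output of the run that follows is the configuration at time `T + 1`. The
initial positions, at time `0`, are given. -/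
noncomputable def play :
    (T : ℕ) → (Fin T → Fin I.n) → PMF (State × (Fin (T + 1) → I.Config I.augCount))
  | 0, _ => (A.setup.exec ⟨I.inputMem, 0⟩).map fun s => (s, fun _ => I.augInit)
  | T + 1, σ => (play T (fun t => σ t.castSucc)).bind fun o =>
      (A.serve.exec ⟨o.1.mem.write .request 0 0 (σ (Fin.last T)).val, o.1.time⟩).map fun s =>
        (s, Fin.snoc (α := fun _ => I.Config I.augCount) o.2 (I.readConfig s.mem))

/-- The expected movement cost on the request sequence `σ`. -/
noncomputable def expectedCost {T : ℕ} (σ : Fin T → Fin I.n) : ℝ≥0∞ :=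
  ∑' o, A.play I T σ o * ENNReal.ofReal (I.cost o.2)

end OnlineAlgorithm

end WeightedKServer

/-!
A deterministic algorithm proves the theorem, with the better competitive ratio `4 * ℓ ^ 2` in place
of `O(ℓ ^ 2 * log (ℓ + 1))`. The weights are multiplied by a common denominator, so that they are
natural numbers `W j`; class `j` has `2 * ℓ * k j` servers.

**The algorithm.** Each class `j` saves up credits `c j q ≤ W j` for the points `q`. A request `p` is
covered if some class has moved a server to `p` in its current epoch; then nothing happens.
Otherwise `c j p` grows in all classes simultaneously by the same amount `D`, the largest one with
`c j p + D ≤ W j` for all `j`. Each class whose credit for `p` reaches `W j`, and there is one, moves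
its next server to `p`. A class that has moved all its servers begins a new epoch first, in which all
its credits, except that of `p`, are zero and no point is covered. At the beginning, `k j` of the
servers of class `j` count as used in epoch `0` and cover the initial positions, which have the full
credit. This is `Ledger.raise` on the ledger of each class.

**The competitive ratio.** Let `Y j` be the positions of the servers of class `j` in an arbitrary
solution with `k j` servers. For each class there is a potential with three parts: the credit that is
lacking on `Y j` (`Ledger.lack`), the savings of the current epoch (`Ledger.savings`), and those of
them that are not spent yet (`Ledger.unspent`), which pay for the moves. At an uncovered request `p`
some `Y j` contains `p`, so its lack decreases by `D`, with a weight that outbalances the savings of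
the `ℓ` classes (`Ledger.sum_potential_raise_le`). A new epoch of class `j` creates a lack of at most
`k j * W j`, but it erases savings of `2 * ℓ * k j * W j` (`Ledger.Valid.potential_raise_le`). In epoch
`0`, where `k j` servers were not paid for, this still holds as the potential counts twice. A move
in the other solution raises the potential by at most `4 * ℓ ^ 2 * W j`
(`Ledger.Valid.potential_le_of_move`), and the potential is initially zero.

**The running time.** A program that tosses no coin has a deterministic semantics (`Prog.run`,
`Prog.steps`). As `n` may be exponential in the input size, a new epoch cannot erase the credits one
by one; it moves on to unused memory cells instead. All numbers in the memory have `O(N)` digits for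
the input size `N` (`Instance.fits`), so a program without loops takes time `O(N)`
(`Prog.steps_le_of_loopFree`), and the loops have polynomially many rounds.
-/

namespace WeightedKServer

/-! ### Deterministic programs -/

namespace Prog

/-- The program tosses no coin. -/
def FlipFree : Prog → Prop
  | skip => True
  | set _ _ _ _ => True
  | flip _ _ _ => False
  | seq p q => p.FlipFree ∧ q.FlipFree
  | ite _ p q => p.FlipFree ∧ q.FlipFree
  | loop _ p => p.FlipFree

/-- The memory after the execution of a program that tosses no coin (a coin toss, which does not
occur, is treated as `skip`). -/
def run : Prog → Mem → Mem
  | skip, M => M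
  | set a i j e, M => M.write a (i.eval M) (j.eval M) (e.eval M)
  | flip _ _ _, M => M
  | seq p q, M => q.run (p.run M)
  | ite e p q, M => if e.eval M ≠ 0 then p.run M else q.run M
  | loop e p, M => p.run^[e.eval M] M

/-- The time that a program takes that tosses no coin. -/
def steps : Prog → Mem → ℕ
  | skip, _ => 1
  | set _ i j e, M => i.cost M + j.cost M + e.cost M + 1
  | flip _ _ _, _ => 0
  | seq p q, M => p.steps M + q.steps (p.run M)
  | ite e p q, M => e.cost M + 1 + if e.eval M ≠ 0 then p.steps M else q.steps M
  | loop e p, M => e.cost M + 1 + ∑ i ∈ Finset.range (e.eval M), (p.steps (p.run^[i] M) + 1)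

theorem run_seq (p q : Prog) (M : Mem) : (seq p q).run M = q.run (p.run M) := rfl

theorem steps_seq (p q : Prog) (M : Mem) :
    (seq p q).steps M = p.steps M + q.steps (p.run M) := rfl

theorem steps_ite (e : Expr) (p q : Prog) (M : Mem) :
    (ite e p q).steps M = e.cost M + 1 + if e.eval M ≠ 0 then p.steps M else q.steps M := rfl

theorem rounds_eq_pure {p : Prog}
    (hp : ∀ s : State, p.exec s = PMF.pure ⟨p.run s.mem, s.time + p.steps s.mem⟩) (N : ℕ) :
    ∀ s : State, rounds p.exec N s = PMF.pure
      ⟨p.run^[N] s.mem, s.time + ∑ i ∈ Finset.range N, (p.steps (p.run^[i] s.mem) + 1)⟩ := by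
  induction N with
  | zero => intro s; simp [rounds]
  | succ N ih =>
    intro s
    rw [rounds, hp, PMF.pure_bind, ih, Finset.sum_range_succ']
    simp only [State.tick, Function.iterate_succ_apply, Function.iterate_zero_apply]
    congr 2
    omega

theorem exec_eq_pure (p : Prog) (hp : p.FlipFree) (s : State) :
    p.exec s = PMF.pure ⟨p.run s.mem, s.time + p.steps s.mem⟩ := by
  induction p generalizing s with
  | skip => rfl
  | set a i j e => rfl
  | flip a i j => exact hp.elim
  | seq p q ihp ihq =>
    simp only [exec, ihp hp.1, PMF.pure_bind, ihq hp.2, run, steps, Nat.add_assoc]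
  | ite e p q ihp ihq =>
    by_cases h : e.eval s.mem = 0 <;>
      simp [exec, run, steps, h, ihp hp.1, ihq hp.2, State.tick, Nat.add_assoc]
  | loop e p ih =>
    simp [exec, run, steps, rounds_eq_pure (ih hp), State.tick, Nat.add_assoc]

end Prog

/-! ### Running times -/

/-- Each entry of the memory has at most `B` binary digits. -/
def Mem.Small (B : ℕ) (M : Mem) : Prop := ∀ a i j, M a i j < 2 ^ B

theorem Mem.Small.mono {B B' : ℕ} {M : Mem} (h : M.Small B) (hB : B ≤ B') : M.Small B' :=
  fun a i j => (h a i j).trans_le (Nat.pow_le_pow_right two_pos hB)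

theorem Mem.Small.write {B : ℕ} {M : Mem} (h : M.Small B) (a : Arr) (i j : ℕ) {v : ℕ}
    (hv : v < 2 ^ B) : (M.write a i j v).Small B := by
  intro a' i' j'
  unfold Mem.write
  split_ifs
  exacts [hv, h _ _ _]

namespace Expr

/-- The value of an expression has at most `e.width * (B + 1)` digits if the entries of the memory
have at most `B`. -/
def width : Expr → ℕ
  | lit c => c + 1
  | get _ _ _ => 1
  | add x y => x.width + y.width
  | sub x y => x.width + y.width
  | mul x y => x.width + y.width
  | div x y => x.width + y.width
  | eq _ _ => 1
  | lt _ _ => 1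
  | len x => x.width

/-- The evaluation of an expression takes time at most `e.effort * (B + 1)` if the entries of the
memory have at most `B` digits. -/
def effort : Expr → ℕ
  | lit c => c + 2
  | get _ i j => i.effort + j.effort + 2
  | add x y => x.effort + y.effort + (x.width + y.width + 1)
  | sub x y => x.effort + y.effort + (x.width + y.width + 1)
  | mul x y => x.effort + y.effort + (x.width + y.width + 1)
  | div x y => x.effort + y.effort + (x.width + y.width + 1)
  | eq x y => x.effort + y.effort + 2
  | lt x y => x.effort + y.effort + 2
  | len x => x.effort + (x.width + 1)

theorem width_pos (e : Expr) : 0 < e.width := by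
  induction e <;> simp only [width] <;> omega

theorem eval_lt (e : Expr) {B : ℕ} {M : Mem} (h : M.Small B) :
    e.eval M < 2 ^ (e.width * (B + 1)) := by
  have le_left (x y : Expr) : 2 ^ (x.width * (B + 1)) ≤ 2 ^ ((x.width + y.width) * (B + 1)) :=
    Nat.pow_le_pow_right two_pos (Nat.mul_le_mul_right _ (Nat.le_add_right _ _))
  have two_le (x : Expr) : 2 ≤ 2 ^ (x.width * (B + 1)) := by
    calc 2 = 2 ^ 1 := rfl
      _ ≤ _ := Nat.pow_le_pow_right two_pos (Nat.mul_pos x.width_pos (Nat.succ_pos B))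
  have one_lt : 1 < 2 ^ (1 * (B + 1)) := Nat.one_lt_two_pow (by omega)
  induction e with
  | lit c =>
    exact Nat.lt_two_pow_self.trans_le (Nat.pow_le_pow_right two_pos
      ((Nat.le_succ c).trans (Nat.le_mul_of_pos_right _ (Nat.succ_pos B))))
  | get a i j =>
    exact (h _ _ _).trans_le (Nat.pow_le_pow_right two_pos (by simp only [width]; omega))
  | add x y ihx ihy =>
    simp only [eval, width, add_mul, pow_add] at *
    nlinarith [two_le x, two_le y]
  | sub x y ihx ihy => exact ((Nat.sub_le _ _).trans_lt ihx).trans_le (le_left x y)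
  | mul x y ihx ihy =>
    simp only [eval, width, add_mul, pow_add]
    exact Nat.mul_lt_mul'' ihx ihy
  | div x y ihx ihy => exact ((Nat.div_le_self _ _).trans_lt ihx).trans_le (le_left x y)
  | eq x y => simp only [eval, width]; split_ifs <;> omega
  | lt x y => simp only [eval, width]; split_ifs <;> omega
  | len x ih =>
    refine lt_of_le_of_lt ?_ ih
    exact Nat.size_le.2 Nat.lt_two_pow_self

theorem bits_eval_le (e : Expr) {B : ℕ} {M : Mem} (h : M.Small B) :
    bits (e.eval M) ≤ (e.width + 1) * (B + 1) := by
  have := Nat.size_le.2 (e.eval_lt h)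
  unfold bits
  rw [add_mul]
  omega

theorem cost_le (e : Expr) {B : ℕ} {M : Mem} (h : M.Small B) :
    e.cost M ≤ e.effort * (B + 1) := by
  have key (e : Expr) := e.bits_eval_le h
  induction e with
  | lit c => exact key (lit c)
  | get a i j ihi ihj =>
    have := key (get a i j); simp only [cost, effort, width, add_mul] at *; omega
  | add x y ihx ihy =>
    have := key (add x y); simp only [cost, effort, width, add_mul] at *; omega
  | sub x y ihx ihy =>
    have := key (sub x y); simp only [cost, effort, width, add_mul] at *; omega
  | mul x y ihx ihy =>
    have := key (mul x y); simp only [cost, effort, width, add_mul] at *; omega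
  | div x y ihx ihy =>
    have := key (div x y); simp only [cost, effort, width, add_mul] at *; omega
  | eq x y ihx ihy =>
    have := key (eq x y); simp only [cost, effort, width, add_mul] at *; omega
  | lt x y ihx ihy =>
    have := key (lt x y); simp only [cost, effort, width, add_mul] at *; omega
  | len x ih =>
    have := key (len x); simp only [cost, effort, width, add_mul] at *; omega

end Expr

namespace Prog

/-- The program has no loop and tosses no coin. -/
def LoopFree : Prog → Prop
  | skip => True
  | set _ _ _ _ => True
  | flip _ _ _ => False
  | seq p q => p.LoopFree ∧ q.LoopFree
  | ite _ p q => p.LoopFree ∧ q.LoopFree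
  | loop _ _ => False

/-- The factor by which a program without loops lengthens the entries of the memory. -/
def growth : Prog → ℕ
  | set _ _ _ e => e.width + 1
  | seq p q => q.growth * (p.growth + 1)
  | ite _ p q => p.growth + q.growth
  | _ => 1

/-- The time of a program without loops, in units of the length of the entries of the memory. -/
def effort : Prog → ℕ
  | set _ i j e => i.effort + j.effort + e.effort + 1
  | seq p q => p.effort + q.effort * (p.growth + 1)
  | ite e p q => e.effort + 1 + p.effort + q.effort
  | _ => 1

theorem Small.run {p : Prog} (hp : p.LoopFree) {B : ℕ} {M : Mem} (h : M.Small B) :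
    (p.run M).Small (p.growth * (B + 1)) := by
  induction p generalizing B M with
  | skip => exact h.mono (by simp only [growth]; omega)
  | set a i j e =>
    refine (h.mono ?_).write _ _ _ ((e.eval_lt h).trans_le (Nat.pow_le_pow_right two_pos ?_)) <;>
      simp only [growth, add_mul] <;> omega
  | flip a i j => exact hp.elim
  | seq p q ihp ihq =>
    refine (ihq hp.2 (ihp hp.1 h)).mono ?_
    simp only [growth, mul_assoc]
    gcongr
    rw [add_mul]
    omega
  | ite e p q ihp ihq =>
    simp only [Prog.run, growth, add_mul]
    split_ifs
    exacts [(ihp hp.1 h).mono (by omega), (ihq hp.2 h).mono (by omega)]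
  | loop e p => exact hp.elim

/-- A program without loops takes time linear in the length of the entries of the memory. -/
theorem steps_le_of_loopFree {p : Prog} (hp : p.LoopFree) {B : ℕ} {M : Mem} (h : M.Small B) :
    p.steps M ≤ p.effort * (B + 1) := by
  induction p generalizing B M with
  | skip => simp [steps, effort]
  | set a i j e =>
    have hi := i.cost_le h
    have hj := j.cost_le h
    have he := e.cost_le h
    simp only [steps, effort, add_mul] at *
    omega
  | flip a i j => exact hp.elim
  | seq p q ihp ihq =>
    simp only [steps, effort]
    have h1 := ihp hp.1 h
    have h2 := ihq hp.2 (Small.run hp.1 h)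
    have h3 : q.effort * (p.growth * (B + 1) + 1) ≤ q.effort * ((p.growth + 1) * (B + 1)) := by
      gcongr
      rw [add_mul]
      omega
    rw [add_mul, mul_assoc]
    omega
  | ite e p q ihp ihq =>
    have he := e.cost_le h
    have h1 := ihp hp.1 h
    have h2 := ihq hp.2 h
    simp only [steps, effort, add_mul] at *
    split_ifs <;> omega
  | loop e p => exact hp.elim

theorem steps_loop_le {e : Expr} {p : Prog} {B τ : ℕ} {M : Mem} (hM : M.Small B)
    (h : ∀ i < e.eval M, p.steps (p.run^[i] M) ≤ τ) :
    (loop e p).steps M ≤ (e.effort + 1) * (B + 1) + e.eval M * (τ + 1) := by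
  have h1 : ∑ i ∈ Finset.range (e.eval M), (p.steps (p.run^[i] M) + 1) ≤ e.eval M * (τ + 1) := by
    simpa using Finset.sum_le_card_nsmul (Finset.range (e.eval M)) _ (τ + 1)
      (fun i hi => Nat.succ_le_succ (h i (Finset.mem_range.1 hi)))
  have h2 := e.cost_le hM
  simp only [steps, add_mul] at *
  omega

theorem steps_loop_le_of_loopFree {e : Expr} {p : Prog} (hp : p.LoopFree) {B : ℕ} {M : Mem}
    (hM : M.Small B) (h : ∀ i < e.eval M, (p.run^[i] M).Small B) :
    (loop e p).steps M ≤ (e.effort + p.effort + 2) * ((B + 1) * (e.eval M + 1)) := by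
  have h1 := steps_loop_le (e := e) hM fun i hi => steps_le_of_loopFree hp (h i hi)
  have h2 : (e.effort + 1) * (B + 1) ≤ (e.effort + 1) * ((B + 1) * (e.eval M + 1)) :=
    Nat.mul_le_mul_left _ (Nat.le_mul_of_pos_right _ (Nat.succ_pos _))
  have h3 : e.eval M * (p.effort * (B + 1) + 1) ≤
      (e.eval M + 1) * (p.effort * (B + 1) + (B + 1)) :=
    Nat.mul_le_mul (Nat.le_succ _) (by omega)
  linarith

end Prog

/-! ### The ledger of a weight class -/

/-- What the algorithm records about one weight class of weight `W` on the points `0, …, n - 1`.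
The records of a point `q` are in the cell `epoch * n + q` of `credit` and `cover`, so that passing
to the next epoch erases all of them at once: `credit` (at most `W`) is what was saved up for `q` in
this epoch, and `cover` is nonzero if a server of the class was placed on `q` in this epoch. The
servers in the slots below `used` were placed in this epoch (or belong to the initial ones, in epoch
`0`), and `pos` is the list of all positions. -/
@[ext]
structure Ledger where
  epoch : ℕ
  used : ℕ
  credit : ℕ → ℕ
  cover : ℕ → ℕ
  pos : ℕ → ℕ

namespace Ledger

/-- The cell of the point `q` in the current epoch. -/
def cell (n : ℕ) (s : Ledger) (q : ℕ) : ℕ := s.epoch * n + q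

/-- Save `D` for the point `p`. -/
def save (n p D : ℕ) (s : Ledger) : Ledger :=
  { s with credit := Function.update s.credit (s.cell n p) (s.credit (s.cell n p) + D) }

/-- Begin a new epoch, in which only `p` has a credit, the full one. -/
def flush (n p W : ℕ) (s : Ledger) : Ledger :=
  { s with
    epoch := s.epoch + 1
    used := 0
    credit := Function.update s.credit ((s.epoch + 1) * n + p) W }

/-- Move the next server to the point `p`. -/
def place (n p : ℕ) (s : Ledger) : Ledger :=
  { s with
    used := s.used + 1
    cover := Function.update s.cover (s.cell n p) 1
    pos := Function.update s.pos s.used p }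

/-- The reaction of a class of `m` servers of weight `W` to an uncovered request `p`: the credit of
`p` increases by `D`, and if it reaches `W`, a server is moved to `p`, in a new epoch if no server
is left in this one. -/
def raise (n m W p D : ℕ) (s : Ledger) : Ledger :=
  if (s.save n p D).credit ((s.save n p D).cell n p) = W then
    (if s.used = m then (s.save n p D).flush n p W else s.save n p D).place n p
  else s.save n p D

/-- The invariant of the ledger of a class of `m` servers of weight `W` after `t` requests, where
`k` of the servers are initially counted as used. -/
structure Valid (n k m W t : ℕ) (s : Ledger) : Prop where
  epoch_le : s.epoch ≤ t
  used_le : s.used ≤ m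
  le_used : s.epoch = 0 → k ≤ s.used
  credit_le : ∀ q < n, s.credit (s.cell n q) ≤ W
  credit_fresh : ∀ x, (s.epoch + 1) * n ≤ x → s.credit x = 0
  cover_fresh : ∀ x, (s.epoch + 1) * n ≤ x → s.cover x = 0
  covered : ∀ q < n, s.cover (s.cell n q) ≠ 0 → ∃ i < s.used, s.pos i = q
  pos_lt : ∀ i, s.pos i < n

variable {n k m W t p D : ℕ} {s : Ledger}

theorem Valid.mono (h : s.Valid n k m W t) {t' : ℕ} (ht : t ≤ t') : s.Valid n k m W t' :=
  { h with epoch_le := h.epoch_le.trans ht }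

theorem Valid.save (h : s.Valid n k m W t) (hD : s.credit (s.cell n p) + D ≤ W) (hp : p < n) :
    (s.save n p D).Valid n k m W t where
  epoch_le := h.epoch_le
  used_le := h.used_le
  le_used := h.le_used
  credit_le q hq := by
    simp only [Ledger.save, cell, Function.update_apply, add_right_inj]
    split_ifs
    exacts [hD, h.credit_le q hq]
  credit_fresh x hx := by
    have hx' : (s.epoch + 1) * n ≤ x := hx
    have : x ≠ s.cell n p := by
      rw [Nat.succ_mul] at hx'
      unfold cell
      omega
    simp only [Ledger.save, Function.update_of_ne this]
    exact h.credit_fresh x hx'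
  cover_fresh := h.cover_fresh
  covered := h.covered
  pos_lt := h.pos_lt

theorem Valid.flush (h : s.Valid n k m W t) (hp : p < n) :
    (s.flush n p W).Valid n k m W (t + 1) where
  epoch_le := Nat.succ_le_succ h.epoch_le
  used_le := Nat.zero_le _
  le_used h0 := absurd h0 (Nat.succ_ne_zero _)
  credit_le q hq := by
    simp only [Ledger.flush, cell, Function.update_apply]
    split_ifs
    · exact le_rfl
    · rw [h.credit_fresh _ (Nat.le_add_right _ _)]
      exact Nat.zero_le _
  credit_fresh x hx := by
    have hx' : (s.epoch + 1 + 1) * n ≤ x := hx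
    rw [Nat.succ_mul] at hx'
    have : x ≠ (s.epoch + 1) * n + p := by omega
    simp only [Ledger.flush, Function.update_of_ne this]
    exact h.credit_fresh x (by omega)
  cover_fresh x hx := by
    have hx' : (s.epoch + 1 + 1) * n ≤ x := hx
    rw [Nat.succ_mul] at hx'
    exact h.cover_fresh x (by omega)
  covered q _ hc := absurd (h.cover_fresh _ (Nat.le_add_right _ _)) hc
  pos_lt := h.pos_lt

theorem Valid.place (h : s.Valid n k m W t) (hp : p < n) (hu : s.used < m) :
    (s.place n p).Valid n k m W t where
  epoch_le := h.epoch_le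
  used_le := hu
  le_used h0 := (h.le_used h0).trans (Nat.le_succ _)
  credit_le := h.credit_le
  credit_fresh := h.credit_fresh
  cover_fresh x hx := by
    have hx' : (s.epoch + 1) * n ≤ x := hx
    have : x ≠ s.cell n p := by
      rw [Nat.succ_mul] at hx'
      unfold cell
      omega
    simp only [Ledger.place, Function.update_of_ne this]
    exact h.cover_fresh x hx'
  covered q hq hc := by
    by_cases hqp : q = p
    · exact ⟨s.used, Nat.lt_succ_self _, by simp [Ledger.place, hqp]⟩
    · have hc' : s.cover (s.cell n q) ≠ 0 := by
        simpa [Ledger.place, cell, Function.update_apply, hqp] using hc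
      obtain ⟨i, hi, hpos⟩ := h.covered q hq hc'
      exact ⟨i, Nat.lt_succ_of_lt hi, by simp [Ledger.place, Function.update_of_ne hi.ne, hpos]⟩
  pos_lt i := by
    simp only [Ledger.place, Function.update_apply]
    split_ifs
    exacts [hp, h.pos_lt i]

theorem Valid.raise (h : s.Valid n k m W t) (hm : 0 < m)
    (hD : s.credit (s.cell n p) + D ≤ W) (hp : p < n) :
    (s.raise n m W p D).Valid n k m W (t + 1) := by
  have hs := h.save hD hp
  unfold Ledger.raise
  split_ifs with h1 h2
  · exact (hs.flush hp).place hp hm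
  · exact (hs.mono (Nat.le_succ t)).place hp (lt_of_le_of_ne h.used_le h2)
  · exact hs.mono (Nat.le_succ t)

/-- If the credit of `p` reaches the weight, `p` becomes covered. -/
theorem cover_raise (hD : s.credit (s.cell n p) + D = W) :
    (s.raise n m W p D).cover ((s.raise n m W p D).cell n p) ≠ 0 := by
  have h1 : (s.save n p D).credit ((s.save n p D).cell n p) = W := by
    simpa [save, cell] using hD
  simp only [raise, h1, if_true]
  simp [place, cell]

/-! ### The potential of a weight class -/

/-- The total credit of the points that are not covered: the savings not spent yet. -/
def unspent (n : ℕ) (s : Ledger) : ℤ :=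
  ∑ q ∈ Finset.range n, if s.cover (s.cell n q) = 0 then (s.credit (s.cell n q) : ℤ) else 0

/-- The total credit that is lacking on the positions `Y` of the servers of the class in a
reference solution. -/
def lack (n W : ℕ) (s : Ledger) {k : ℕ} (Y : Fin k → ℕ) : ℤ :=
  ∑ i, ((W : ℤ) - s.credit (s.cell n (Y i)))

/-- Epoch `0` counts twice. There `k` of the servers are in use without having been paid for. -/
def factor (s : Ledger) : ℤ := if s.epoch = 0 then 2 else 1

/-- The savings of the current epoch, including those spent. -/
def savings (n k W : ℕ) (s : Ledger) : ℤ :=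
  W * (s.used - if s.epoch = 0 then (k : ℤ) else 0) + s.unspent n

/-- The potential of a weight class in an instance with `ℓ` classes. -/
def potential (ℓ n W : ℕ) (s : Ledger) {k : ℕ} (Y : Fin k → ℕ) : ℤ :=
  ℓ * (s.factor * (2 * ℓ * s.lack n W Y + s.savings n k W)) + s.unspent n

/-- The number of servers among the first `m` whose positions differ. -/
def moves (m : ℕ) (s s' : Ledger) : ℕ :=
  ((Finset.range m).filter fun i => s'.pos i ≠ s.pos i).card

theorem factor_pos (s : Ledger) : 0 < s.factor := by
  unfold factor; split_ifs <;> norm_num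

theorem factor_le (s : Ledger) : s.factor ≤ 2 := by
  unfold factor; split_ifs <;> norm_num

theorem unspent_nonneg (s : Ledger) : 0 ≤ s.unspent n :=
  Finset.sum_nonneg fun q _ => by split_ifs <;> positivity

theorem Valid.lack_nonneg (h : s.Valid n k m W t) {Y : Fin k → ℕ} (hY : ∀ i, Y i < n) :
    0 ≤ s.lack n W Y :=
  Finset.sum_nonneg fun i _ => sub_nonneg.2 (by exact_mod_cast h.credit_le _ (hY i))

theorem Valid.potential_nonneg {ℓ : ℕ} (h : s.Valid n k m W t) {Y : Fin k → ℕ}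
    (hY : ∀ i, Y i < n) : 0 ≤ s.potential ℓ n W Y := by
  have h1 := h.lack_nonneg hY
  have h2 := s.unspent_nonneg (n := n)
  have h3 : (0 : ℤ) ≤ s.used - if s.epoch = 0 then (k : ℤ) else 0 := by
    split_ifs with h0
    · have := h.le_used h0; omega
    · simp
  have h4 := s.factor_pos.le
  unfold potential savings
  positivity

theorem moves_place_le (m n p : ℕ) (s s₀ : Ledger) (h : s.pos = s₀.pos) :
    moves m s₀ (s.place n p) ≤ 1 := by
  refine (Finset.card_le_card (t := {s.used}) fun i hi => ?_).trans_eq (Finset.card_singleton _)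
  by_contra hne
  rw [Finset.mem_singleton] at hne
  simp [place, Function.update_of_ne hne, h] at hi

theorem unspent_save (hp : p < n) (hc : s.cover (s.cell n p) = 0) :
    (s.save n p D).unspent n = s.unspent n + D := by
  unfold unspent
  rw [← Finset.add_sum_erase _ _ (Finset.mem_range.2 hp),
    ← Finset.add_sum_erase (Finset.range n) (fun q => if s.cover (s.cell n q) = 0 then
      (s.credit (s.cell n q) : ℤ) else 0) (Finset.mem_range.2 hp)]
  have : ∀ q ∈ (Finset.range n).erase p,
      (if (s.save n p D).cover ((s.save n p D).cell n q) = 0 then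
        ((s.save n p D).credit ((s.save n p D).cell n q) : ℤ) else 0) =
      if s.cover (s.cell n q) = 0 then (s.credit (s.cell n q) : ℤ) else 0 := by
    intro q hq
    simp only [save, cell, Function.update_apply, add_right_inj, Finset.ne_of_mem_erase hq,
      if_false]
    rfl
  rw [Finset.sum_congr rfl this]
  simp only [save, cell, Function.update_self] at *
  simp only [hc, if_true]
  push_cast
  ring

theorem unspent_place (hp : p < n) (hc : s.cover (s.cell n p) = 0) :
    (s.place n p).unspent n = s.unspent n - s.credit (s.cell n p) := by
  unfold unspent
  rw [← Finset.add_sum_erase _ _ (Finset.mem_range.2 hp),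
    ← Finset.add_sum_erase (Finset.range n) (fun q => if s.cover (s.cell n q) = 0 then
      (s.credit (s.cell n q) : ℤ) else 0) (Finset.mem_range.2 hp)]
  have : ∀ q ∈ (Finset.range n).erase p,
      (if (s.place n p).cover ((s.place n p).cell n q) = 0 then
        ((s.place n p).credit ((s.place n p).cell n q) : ℤ) else 0) =
      if s.cover (s.cell n q) = 0 then (s.credit (s.cell n q) : ℤ) else 0 := by
    intro q hq
    simp only [place, cell, Function.update_apply, add_right_inj, Finset.ne_of_mem_erase hq,
      if_false]
    rfl
  rw [Finset.sum_congr rfl this]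
  simp only [place, cell, Function.update_self] at *
  simp only [hc, if_true]
  simp

theorem Valid.unspent_flush (h : s.Valid n k m W t) (hp : p < n) :
    (s.flush n p W).unspent n = W := by
  unfold unspent
  rw [Finset.sum_eq_single_of_mem p (Finset.mem_range.2 hp)]
  · simp [Ledger.flush, cell, h.cover_fresh _ (Nat.le_add_right _ _)]
  · intro q _ hq
    simp [Ledger.flush, cell, hq, h.credit_fresh _ (Nat.le_add_right _ _)]

theorem credit_le_unspent (hp : p < n) (hc : s.cover (s.cell n p) = 0) :
    (s.credit (s.cell n p) : ℤ) ≤ s.unspent n := by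
  have := Finset.single_le_sum (f := fun q => if s.cover (s.cell n q) = 0 then
      (s.credit (s.cell n q) : ℤ) else 0) (fun q _ => by split_ifs <;> positivity)
      (Finset.mem_range.2 hp)
  simp only [hc, if_true] at this
  exact this

theorem lack_save_le {Y : Fin k → ℕ} :
    (s.save n p D).lack n W Y ≤ s.lack n W Y - if ∃ i, Y i = p then (D : ℤ) else 0 := by
  have key : (s.save n p D).lack n W Y = s.lack n W Y - ∑ i, if Y i = p then (D : ℤ) else 0 := by
    unfold lack
    rw [← Finset.sum_sub_distrib]
    refine Finset.sum_congr rfl fun i _ => ?_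
    by_cases h : Y i = p <;> simp [save, cell, h]
    ring
  rw [key]
  gcongr
  split_ifs with h
  · obtain ⟨i, hi⟩ := h
    have := Finset.single_le_sum (f := fun i => if Y i = p then (D : ℤ) else 0)
      (fun q _ => by split_ifs <;> positivity) (Finset.mem_univ i)
    simpa [hi] using this
  · exact Finset.sum_nonneg fun i _ => by split_ifs <;> positivity

theorem lack_le {Y : Fin k → ℕ} : s.lack n W Y ≤ k * W := by
  unfold lack
  refine (Finset.sum_le_card_nsmul _ _ (W : ℤ) fun i _ => ?_).trans_eq (by simp)
  simp

/-- The change of the potential of one class when an uncovered point `p` is requested: it pays for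
the moves of the class up to `D + ℓ * factor * D`, and if the reference solution has a server of the
class on `p`, there is a gain of `2 * ℓ ^ 2 * factor * D`. -/
theorem Valid.potential_raise_le {ℓ : ℕ} (hℓ : 0 < ℓ) (h : s.Valid n k (2 * ℓ * k) W t)
    (hp : p < n) (hc : s.cover (s.cell n p) = 0) (hD : s.credit (s.cell n p) + D ≤ W)
    {Y : Fin k → ℕ} (hY : ∀ i, Y i < n) :
    (s.raise n (2 * ℓ * k) W p D).potential ℓ n W Y +
        W * moves (2 * ℓ * k) s (s.raise n (2 * ℓ * k) W p D) ≤
      s.potential ℓ n W Y + D + ℓ * s.factor * D -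
        if ∃ i, Y i = p then 2 * (ℓ : ℤ) ^ 2 * s.factor * D else 0 := by
  have hs := h.save hD hp
  have hlack := lack_save_le (s := s) (n := n) (W := W) (D := D) (p := p) (Y := Y)
  have hun := unspent_save (D := D) hp hc
  have hfac : (s.save n p D).factor = s.factor := rfl
  have hused : (s.save n p D).used = s.used := rfl
  have hep : (s.save n p D).epoch = s.epoch := rfl
  have hf := s.factor_pos
  have hind : (if ∃ i, Y i = p then 2 * (ℓ : ℤ) ^ 2 * s.factor * D else 0) =
      2 * (ℓ : ℤ) ^ 2 * s.factor * if ∃ i, Y i = p then (D : ℤ) else 0 := by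
    split_ifs <;> simp
  rw [hind]
  -- Before a server is moved, the credit of `p` has been raised.
  have hsave : (s.save n p D).potential ℓ n W Y ≤ s.potential ℓ n W Y + D + ℓ * s.factor * D -
      2 * (ℓ : ℤ) ^ 2 * s.factor * if ∃ i, Y i = p then (D : ℤ) else 0 := by
    unfold potential savings
    rw [hfac, hun, hused, hep]
    have : 0 ≤ 2 * (ℓ : ℤ) ^ 2 * s.factor := by positivity
    have := mul_le_mul_of_nonneg_left hlack this
    linarith
  -- A server that is moved is paid for by the credit of its new position.
  have hplace : ∀ s' : Ledger, s'.pos = s.pos → s'.cover (s'.cell n p) = 0 →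
      s'.credit (s'.cell n p) = W →
      (s'.place n p).potential ℓ n W Y + W * moves (2 * ℓ * k) s (s'.place n p) ≤
        s'.potential ℓ n W Y := by
    intro s' h1 h2 h3
    have hm : (moves (2 * ℓ * k) s (s'.place n p) : ℤ) ≤ 1 := by
      exact_mod_cast moves_place_le _ n p s' s h1
    have hm' := mul_le_mul_of_nonneg_left hm (Int.natCast_nonneg W)
    have e1 : (s'.place n p).lack n W Y = s'.lack n W Y := rfl
    have e2 : (s'.place n p).factor = s'.factor := rfl
    have e3 : (s'.place n p).savings n k W = s'.savings n k W := by
      unfold savings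
      rw [unspent_place hp h2, h3]
      have : (s'.place n p).epoch = s'.epoch := rfl
      simp only [this, show (s'.place n p).used = s'.used + 1 from rfl]
      push_cast
      ring
    unfold potential
    rw [e1, e2, e3, unspent_place hp h2, h3]
    linarith
  generalize (if ∃ i, Y i = p then (D : ℤ) else 0) = g at *
  unfold Ledger.raise
  split_ifs with h1 h2
  · refine (hplace ((s.save n p D).flush n p W) rfl ?_ ?_).trans ?_
    · exact h.cover_fresh _ (Nat.le_add_right _ _)
    · simp [Ledger.flush, cell]
    -- The savings of the old epoch pay for the credit that is erased.
    refine le_trans ?_ hsave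
    have hW : (W : ℤ) ≤ (s.save n p D).unspent n := by
      rw [← h1]
      exact credit_le_unspent hp hc
    have hnn := hs.lack_nonneg hY
    have hfl := lack_le (s := (s.save n p D).flush n p W) (n := n) (W := W) (Y := Y)
    have hfac' : ((s.save n p D).flush n p W).factor = 1 := if_neg (Nat.succ_ne_zero _)
    have hsav' : ((s.save n p D).flush n p W).savings n k W = W := by
      unfold savings
      rw [hs.unspent_flush hp]
      simp [Ledger.flush]
    unfold potential
    rw [hs.unspent_flush hp, hsav', hfac', hfac]
    have hmain : (2 * ℓ * ((s.save n p D).flush n p W).lack n W Y + W : ℤ) ≤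
        s.factor * (2 * ℓ * (s.save n p D).lack n W Y + (s.save n p D).savings n k W) := by
      have h3 : (2 * ℓ * ((s.save n p D).flush n p W).lack n W Y : ℤ) ≤ 2 * ℓ * (k * W) :=
        mul_le_mul_of_nonneg_left hfl (by positivity)
      have h4 : (0 : ℤ) ≤ 2 * ℓ * (s.save n p D).lack n W Y := by positivity
      have h5 : (k : ℤ) * W ≤ ℓ * (k * W) :=
        le_mul_of_one_le_left (by positivity) (by exact_mod_cast hℓ)
      unfold savings factor
      rw [hused, hep, h2]
      push_cast
      split_ifs <;> linarith
    have := mul_le_mul_of_nonneg_left hmain (Int.natCast_nonneg ℓ)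
    linarith
  · exact (hplace (s.save n p D) rfl hc h1).trans hsave
  · have : moves (2 * ℓ * k) s (s.save n p D) = 0 := by
      simp [moves, Ledger.save]
    rw [this]
    simpa using hsave

/-- If the reference solution has a server on the requested point, the total potential pays for the
moves of all classes. -/
theorem sum_potential_raise_le {ℓ n t p D : ℕ} {k W : Fin ℓ → ℕ} {L : Fin ℓ → Ledger}
    (h : ∀ j, (L j).Valid n (k j) (2 * ℓ * k j) (W j) t) (hp : p < n)
    (hc : ∀ j, (L j).cover ((L j).cell n p) = 0)
    (hD : ∀ j, (L j).credit ((L j).cell n p) + D ≤ W j)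
    {Y : (j : Fin ℓ) → Fin (k j) → ℕ} (hY : ∀ j i, Y j i < n) (hs : ∃ j i, Y j i = p) :
    ∑ j, (((L j).raise n (2 * ℓ * k j) (W j) p D).potential ℓ n (W j) (Y j) +
        W j * moves (2 * ℓ * k j) (L j) ((L j).raise n (2 * ℓ * k j) (W j) p D)) ≤
      ∑ j, (L j).potential ℓ n (W j) (Y j) := by
  obtain ⟨j₀, i₀, hi₀⟩ := hs
  have hℓ : 0 < ℓ := j₀.pos
  have h1 := Finset.sum_le_sum fun (j : Fin ℓ) (_ : j ∈ Finset.univ) =>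
    (h j).potential_raise_le hℓ hp (hc j) (hD j) (hY j)
  refine h1.trans ?_
  have h2 : (2 * (ℓ : ℤ) ^ 2 * (L j₀).factor * D) ≤
      ∑ j, if ∃ i, Y j i = p then 2 * (ℓ : ℤ) ^ 2 * (L j).factor * D else 0 := by
    have := Finset.single_le_sum (f := fun j : Fin ℓ =>
      if ∃ i, Y j i = p then 2 * (ℓ : ℤ) ^ 2 * (L j).factor * D else 0)
      (fun j _ => by
        have := (L j).factor_pos
        split_ifs <;> positivity) (Finset.mem_univ j₀)
    simp only [show ∃ i, Y j₀ i = p from ⟨i₀, hi₀⟩, if_true] at this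
    exact this
  have h3 : ∑ j, (L j).factor ≤ 2 * (ℓ - 1) + (L j₀).factor := by
    rw [← Finset.add_sum_erase _ _ (Finset.mem_univ j₀), add_comm]
    gcongr
    refine (Finset.sum_le_card_nsmul _ _ 2 fun j _ => (L j).factor_le).trans_eq ?_
    rw [Finset.card_erase_of_mem (Finset.mem_univ _), Finset.card_univ, Fintype.card_fin,
      nsmul_eq_mul, Nat.cast_sub hℓ]
    push_cast
    ring
  simp only [Finset.sum_sub_distrib, Finset.sum_add_distrib, ← Finset.mul_sum, ← Finset.sum_mul,
    Finset.sum_const, Finset.card_univ, Fintype.card_fin, nsmul_eq_mul]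
  have h4 : (ℓ : ℤ) * (∑ j, (L j).factor) * D ≤ ℓ * (2 * (ℓ - 1) + (L j₀).factor) * D := by
    gcongr
  have h5 : 0 ≤ ((L j₀).factor - 1) * ((ℓ : ℤ) * (2 * ℓ - 1) * D) := by
    have := (L j₀).factor_pos
    have h6 : (0 : ℤ) ≤ 2 * ℓ - 1 := by omega
    exact mul_nonneg (by omega) (by positivity)
  nlinarith

/-- A move of a server of the reference solution raises the potential by at most `4 * ℓ ^ 2 * W`. -/
theorem Valid.potential_le_of_move {ℓ n k m W t : ℕ} {s : Ledger} (h : s.Valid n k m W t)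
    {Y Y' : Fin k → ℕ} (hY : ∀ i, Y i < n) :
    s.potential ℓ n W Y' ≤
      s.potential ℓ n W Y + 4 * ℓ ^ 2 * (W * ∑ i, if Y' i ≠ Y i then 1 else 0) := by
  have h1 : s.lack n W Y' ≤ s.lack n W Y + W * ∑ i, if Y' i ≠ Y i then 1 else 0 := by
    unfold lack
    rw [Finset.mul_sum, ← Finset.sum_add_distrib]
    refine Finset.sum_le_sum fun i _ => ?_
    have := h.credit_le _ (hY i)
    split_ifs with hi
    · omega
    · rw [not_not.1 hi]; simp
  have h0 : (0 : ℤ) ≤ W * ∑ i, if Y' i ≠ Y i then 1 else 0 :=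
    mul_nonneg (by positivity) (Finset.sum_nonneg fun i _ => by split_ifs <;> norm_num)
  generalize ((W : ℤ) * ∑ i, if Y' i ≠ Y i then 1 else 0) = x at *
  have hf := s.factor_pos
  have hf' := s.factor_le
  have h2 : (ℓ : ℤ) * (s.factor * (2 * ℓ * s.lack n W Y' + s.savings n k W)) ≤
      ℓ * (s.factor * (2 * ℓ * (s.lack n W Y + x) + s.savings n k W)) := by gcongr
  have h3 : s.factor * (2 * (ℓ : ℤ) ^ 2 * x) ≤ 2 * (2 * (ℓ : ℤ) ^ 2 * x) := by gcongr
  unfold potential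
  linarith

/-- The ledger in which the servers are on the positions `start 0, …, start (k - 1)`, each of them
several times. -/
structure Initial (n k m W : ℕ) (start : ℕ → ℕ) (s : Ledger) : Prop where
  epoch : s.epoch = 0
  used : s.used = k
  pos : ∀ i < m, s.pos i = start (i % k)
  pos_lt : ∀ i, s.pos i < n
  credit : ∀ q, s.credit q = if ∃ i < k, start i = q then W else 0
  cover : ∀ q, s.cover q = if ∃ i < k, start i = q then 1 else 0

namespace Initial

variable {n k m W : ℕ} {start : ℕ → ℕ} {s : Ledger}

theorem valid (h : s.Initial n k m W start) (hk : k ≤ m) (hs : ∀ i < k, start i < n) :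
    s.Valid n k m W 0 := by
  have hfresh : ∀ x, (s.epoch + 1) * n ≤ x → ¬ ∃ i < k, start i = x := by
    rintro x hx ⟨i, hi, rfl⟩
    have := hs i hi
    rw [h.epoch] at hx
    omega
  refine ⟨h.epoch.le, h.used.trans_le hk, fun _ => h.used.ge, fun q _ => ?_, fun x hx => ?_,
    fun x hx => ?_, fun q _ hc => ?_, h.pos_lt⟩
  · rw [h.credit]
    split_ifs <;> simp
  · rw [h.credit, if_neg (hfresh x hx)]
  · rw [h.cover, if_neg (hfresh x hx)]
  · rw [h.cover] at hc
    simp only [ne_eq, ite_eq_right_iff, one_ne_zero, imp_false, not_not, cell, h.epoch, zero_mul,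
      zero_add] at hc
    obtain ⟨i, hi, rfl⟩ := hc
    exact ⟨i, h.used ▸ hi, by rw [h.pos i (hi.trans_le hk), Nat.mod_eq_of_lt hi]⟩

theorem potential_eq {ℓ : ℕ} (h : s.Initial n k m W start) :
    s.potential ℓ n W (fun i : Fin k => start i) = 0 := by
  have h1 : s.unspent n = 0 := by
    refine Finset.sum_eq_zero fun q _ => ?_
    rw [h.cover, h.credit]
    split_ifs <;> simp_all
  have h2 : s.lack n W (fun i : Fin k => start i) = 0 := by
    refine Finset.sum_eq_zero fun i _ => ?_
    rw [cell, h.epoch, h.credit, if_pos ⟨i, i.2, by simp⟩, sub_self]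
  have h3 : s.savings n k W = 0 := by
    rw [savings, h1, h.used, if_pos h.epoch]
    simp
  rw [potential, h1, h2, h3]
  simp

end Initial

end Ledger

/-! ### The program -/

theorem Mem.write_of_ne {a a' : Arr} (h : a' ≠ a) (M : Mem) (i j v : ℕ) :
    M.write a i j v a' = M a' := by
  funext i' j'
  simp [Mem.write, h]

theorem Mem.write_row_of_ne {i i' : ℕ} (h : i' ≠ i) (M : Mem) (a a' : Arr) (j v : ℕ) :
    M.write a i j v a' i' = M a' i' := by
  funext j'
  simp [Mem.write, h]

theorem Mem.write_row_self (M : Mem) (a : Arr) (i j v : ℕ) :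
    M.write a i j v a i = Function.update (M a i) j v := by
  funext j'
  simp [Mem.write, Function.update_apply]

namespace Algorithm

open WeightedKServer.Expr WeightedKServer.Prog

local infixr:60 " ;; " => Prog.seq

/-- The array of the credits of the ledgers. -/
abbrev credits : Arr := .work 0
/-- The array of the covers of the ledgers. -/
abbrev covers : Arr := .work 1
/-- The epochs of the ledgers. -/
abbrev epochs : Arr := .work 2
/-- The numbers of used servers of the ledgers. -/
abbrev useds : Arr := .work 3
/-- The weights of the classes, multiplied by a common denominator. -/
abbrev weights : Arr := .work 4
/-- The scalar that runs through the classes. -/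
abbrev index : Arr := .work 5
/-- The scalar that tells whether a request is covered. -/
abbrev found : Arr := .work 6
/-- The scalar for the least amount by which the credit of a request is short of a weight. -/
abbrev gap : Arr := .work 7
/-- The scalar that runs through the servers of a class. -/
abbrev slot : Arr := .work 8
/-- The scalar for the common denominator of the weights. -/
abbrev denom : Arr := .work 9

/-- The value of a scalar. -/
abbrev scalar (a : Arr) : Expr := get a (lit 0) (lit 0)

/-- The assignment to a scalar. -/
abbrev setScalar (a : Arr) (e : Expr) : Prog := set a (lit 0) (lit 0) e

/-- The entry of an array for the current class. -/
abbrev entry (a : Arr) : Expr := get a (scalar index) (lit 0)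

/-- The cell of the request in the ledger of the current class. -/
abbrev cellExpr : Expr := add (mul (entry epochs) (scalar .points)) (scalar .request)

/-- The entry of an array for the current class in the cell of the request. -/
abbrev record (a : Arr) : Expr := get a (scalar index) cellExpr

/-- The number of servers of the current class. -/
abbrev capacity : Expr := mul (mul (lit 2) (scalar .classes)) (entry .count)

/-- Proceed to the next class. -/
def next : Prog := setScalar index (add (scalar index) (lit 1))

/-- `Ledger.save` for the current class. -/
def saveProg : Prog := set credits (scalar index) cellExpr (add (record credits) (scalar gap))

/-- `Ledger.flush` for the current class. -/
def flushProg : Prog :=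
  set epochs (scalar index) (lit 0) (add (entry epochs) (lit 1)) ;;
  set useds (scalar index) (lit 0) (lit 0) ;;
  set credits (scalar index) cellExpr (entry weights)

/-- `Ledger.place` for the current class. -/
def placeProg : Prog :=
  set .position (scalar index) (entry useds) (scalar .request) ;;
  set covers (scalar index) cellExpr (lit 1) ;;
  set useds (scalar index) (lit 0) (add (entry useds) (lit 1))

/-- `Ledger.raise` for the current class. -/
def raiseProg : Prog :=
  saveProg ;;
  ite (eq (record credits) (entry weights))
    (ite (eq (entry useds) capacity) flushProg skip ;; placeProg) skip ;;
  next

/-- Update `found` and `gap` for the current class. Due to the truncation of the subtraction,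
`x - (x - y)` is the minimum of `x` and `y`. -/
def scanProg : Prog :=
  setScalar found (lt (lit 0) (add (scalar found) (record covers))) ;;
  setScalar gap (sub (scalar gap)
    (sub (scalar gap) (sub (entry weights) (record credits)))) ;;
  next

/-- Prepare the scan of the classes. -/
def serveInit : Prog :=
  setScalar index (lit 0) ;; setScalar found (lit 0) ;; setScalar gap (entry weights)

/-- The program that is run at each request. -/
def serve : Prog :=
  serveInit ;;
  loop (scalar .classes) scanProg ;;
  setScalar index (lit 0) ;;
  ite (scalar found) skip (loop (scalar .classes) raiseProg)

/-- Initialize a server of the current class. -/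
def slotProg : Prog :=
  set .position (scalar index) (scalar slot) (get .start (scalar index)
    (sub (scalar slot) (mul (div (scalar slot) (entry .count)) (entry .count)))) ;;
  set credits (scalar index) (get .position (scalar index) (scalar slot)) (entry weights) ;;
  set covers (scalar index) (get .position (scalar index) (scalar slot)) (lit 1) ;;
  setScalar slot (add (scalar slot) (lit 1))

/-- Initialize the ledger of the current class, up to the initial positions. -/
def classProg : Prog :=
  set weights (scalar index) (lit 0) (mul (entry .num) (div (scalar denom) (entry .den))) ;;
  set useds (scalar index) (lit 0) (entry .count) ;;
  setScalar slot (lit 0)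

/-- Multiply `denom` by the denominator of the weight of the current class. -/
def denomProg : Prog := setScalar denom (mul (scalar denom) (entry .den)) ;; next

/-- The program that is run before the first request. -/
def setup : Prog :=
  setScalar denom (lit 1) ;;
  loop (scalar .classes) denomProg ;;
  setScalar index (lit 0) ;;
  loop (scalar .classes) (classProg ;; loop capacity slotProg ;; next)

/-- The ledger of the class `j` in the memory. -/
def ledger (M : Mem) (j : ℕ) : Ledger :=
  ⟨M epochs j 0, M useds j 0, M credits j, M covers j, M .position j⟩

/-- The memories agree except in the ledger of the class `j`. -/
structure AgreeOff (j : ℕ) (M M' : Mem) : Prop where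
  ledger_eq : ∀ i, i ≠ j → ledger M' i = ledger M i
  eq : ∀ a, a ≠ credits → a ≠ covers → a ≠ epochs → a ≠ useds → a ≠ .position → M' a = M a

theorem AgreeOff.refl (j : ℕ) (M : Mem) : AgreeOff j M M :=
  ⟨fun _ _ => rfl, fun _ _ _ _ _ _ => rfl⟩

theorem AgreeOff.trans {j : ℕ} {M M' M'' : Mem} (h : AgreeOff j M M') (h' : AgreeOff j M' M'') :
    AgreeOff j M M'' :=
  ⟨fun i hi => (h'.ledger_eq i hi).trans (h.ledger_eq i hi), fun a h1 h2 h3 h4 h5 =>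
    (h'.eq a h1 h2 h3 h4 h5).trans (h.eq a h1 h2 h3 h4 h5)⟩

theorem AgreeOff.write {j : ℕ} {M M' : Mem} (h : AgreeOff j M M') {a : Arr} (x v : ℕ)
    (ha : a = credits ∨ a = covers ∨ a = epochs ∨ a = useds ∨ a = .position) :
    AgreeOff j M (M'.write a j x v) := by
  refine h.trans ⟨fun i hi => ?_, fun b h1 h2 h3 h4 h5 => Mem.write_of_ne ?_ _ _ _ _⟩
  · simp only [ledger, Mem.write_row_of_ne hi]
  · rintro rfl
    simp_all

section

variable {B n m W p D j : ℕ} {M : Mem}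

/-- The memory is prepared for the treatment of the class `j`. -/
structure Ready (n m W p D j : ℕ) (M : Mem) : Prop where
  index_eq : M index 0 0 = j
  points_eq : M .points 0 0 = n
  request_eq : M .request 0 0 = p
  gap_eq : M gap 0 0 = D
  weight_eq : M weights j 0 = W
  capacity_eq : 2 * M .classes 0 0 * M .count j 0 = m

theorem Ready.of_agreeOff {i : ℕ} {M' : Mem} (h : Ready n m W p D j M) (h' : AgreeOff i M M') :
    Ready n m W p D j M' := by
  have e (a : Arr) (ha : a = index ∨ a = .points ∨ a = .request ∨ a = gap ∨ a = weights ∨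
      a = .classes ∨ a = .count) : M' a = M a := by
    apply h'.eq <;> (rintro rfl; simp at ha)
  obtain ⟨h1, h2, h3, h4, h5, h6⟩ := h
  refine ⟨?_, ?_, ?_, ?_, ?_, ?_⟩
  · rwa [e _ (by simp)]
  · rwa [e _ (by simp)]
  · rwa [e _ (by simp)]
  · rwa [e _ (by simp)]
  · rwa [e _ (by simp)]
  · rwa [e .classes (by simp), e .count (by simp)]

theorem run_saveProg (h : Ready n m W p D j M) :
    ledger (saveProg.run M) j = (ledger M j).save n p D ∧ AgreeOff j M (saveProg.run M) := by
  constructor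
  · simp [saveProg, Prog.run, Expr.eval, ledger, Ledger.save, Ledger.cell, h.index_eq, h.points_eq,
      h.request_eq, h.gap_eq, Mem.write_of_ne, Mem.write_row_self]
  · simp only [saveProg, Prog.run, Expr.eval, h.index_eq]
    exact (AgreeOff.refl j M).write _ _ (by simp)

theorem run_flushProg (h : Ready n m W p D j M) :
    ledger (flushProg.run M) j = (ledger M j).flush n p W ∧ AgreeOff j M (flushProg.run M) := by
  constructor
  · simp [flushProg, Prog.run, Expr.eval, ledger, Ledger.flush, h.index_eq,
      h.points_eq, h.request_eq, h.weight_eq, Mem.write_of_ne, Mem.write_row_self]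
  · simp only [flushProg, Prog.run, Expr.eval, h.index_eq, Mem.write_of_ne, ne_eq, reduceCtorEq,
      not_false_eq_true, Arr.work.injEq, Nat.reduceEqDiff]
    exact (((AgreeOff.refl j M).write _ _ (by simp)).write _ _ (by simp)).write _ _ (by simp)

theorem run_placeProg (h : Ready n m W p D j M) :
    ledger (placeProg.run M) j = (ledger M j).place n p ∧ AgreeOff j M (placeProg.run M) := by
  constructor
  · simp [placeProg, Prog.run, Expr.eval, ledger, Ledger.place, Ledger.cell, h.index_eq,
      h.points_eq, h.request_eq, Mem.write_of_ne, Mem.write_row_self]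
  · simp only [placeProg, Prog.run, Expr.eval, h.index_eq, Mem.write_of_ne, ne_eq, reduceCtorEq,
      not_false_eq_true, Arr.work.injEq, Nat.reduceEqDiff]
    exact (((AgreeOff.refl j M).write _ _ (by simp)).write _ _ (by simp)).write _ _ (by simp)

end

end Algorithm

namespace Instance

variable (I : Instance)

/-- A common denominator of the weights. -/
def denom : ℕ := ∏ j : Fin I.ℓ, (I.W j).den

/-- The weight of a class, multiplied by the common denominator. -/
def weight (j : Fin I.ℓ) : ℕ := (I.W j).num * (I.denom / (I.W j).den)

/-- The numbers that the algorithm computes have at most `B` digits. -/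
structure Fits (B : ℕ) : Prop where
  n_lt : I.n < 2 ^ B
  ℓ_lt : I.ℓ < 2 ^ B
  augCount_lt : ∀ j, I.augCount j < 2 ^ B
  weight_lt : ∀ j, I.weight j < 2 ^ B
  denom_lt : I.denom < 2 ^ B

theorem augCount_pos (j : Fin I.ℓ) : 0 < I.augCount j :=
  Nat.mul_pos (Nat.mul_pos two_pos I.ℓ_pos) (I.k_pos j)

end Instance

namespace Algorithm

open WeightedKServer.Expr WeightedKServer.Prog

/-! ### The treatment of a request -/

section

variable {B n k m W p D j t : ℕ} {M : Mem}

theorem eval_record (h : Ready n m W p D j M) (a : Arr) :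
    (record a).eval M = M a j ((ledger M j).cell n p) := by
  simp [Expr.eval, ledger, Ledger.cell, h.index_eq, h.points_eq, h.request_eq]

theorem eval_entry (h : Ready n m W p D j M) (a : Arr) : (entry a).eval M = M a j 0 := by
  simp [Expr.eval, h.index_eq]

theorem small_saveProg (h : Ready n m W p D j M) (hS : M.Small B)
    (hD : (ledger M j).credit ((ledger M j).cell n p) + D < 2 ^ B) :
    (saveProg.run M).Small B := by
  refine hS.write _ _ _ ?_
  rw [Expr.eval, eval_record h]
  simpa [Expr.eval, h.gap_eq, ledger] using hD

theorem small_flushProg (h : Ready n m W p D j M) (hS : M.Small B)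
    (he : (ledger M j).epoch + 1 < 2 ^ B) (hW : W < 2 ^ B) : (flushProg.run M).Small B := by
  refine ((hS.write _ _ _ ?_).write _ _ _ ?_).write _ _ _ ?_
  · simpa [Expr.eval, h.index_eq, ledger] using he
  · exact Nat.two_pow_pos B
  · simpa [Prog.run, Expr.eval, h.index_eq, h.weight_eq, Mem.write_of_ne] using hW

theorem small_placeProg (h : Ready n m W p D j M) (hS : M.Small B)
    (hu : (ledger M j).used + 1 < 2 ^ B) (hp : p < 2 ^ B) : (placeProg.run M).Small B := by
  refine ((hS.write _ _ _ ?_).write _ _ _ ?_).write _ _ _ ?_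
  · simpa [Expr.eval, h.request_eq] using hp
  · simp only [Expr.eval]; omega
  · simpa [Prog.run, Expr.eval, h.index_eq, Mem.write_of_ne, ledger] using hu

theorem run_raiseProg (h : Ready n m W p D j M)
    (hv : (ledger M j).Valid n k m W t) (hp : p < n)
    (hD : (ledger M j).credit ((ledger M j).cell n p) + D ≤ W) (hS : M.Small B)
    (hn : n < 2 ^ B) (hmB : m < 2 ^ B) (hW : W < 2 ^ B) (ht : t + 1 < 2 ^ B) (hj : j + 1 < 2 ^ B) :
    ledger (raiseProg.run M) j = (ledger M j).raise n m W p D ∧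
      (∀ i, i ≠ j → ledger (raiseProg.run M) i = ledger M i) ∧
      (∀ a, a ≠ credits → a ≠ covers → a ≠ epochs → a ≠ useds → a ≠ .position → a ≠ index →
        raiseProg.run M a = M a) ∧
      raiseProg.run M index 0 0 = j + 1 ∧ (raiseProg.run M).Small B := by
  suffices ∃ M', raiseProg.run M = next.run M' ∧
      ledger M' j = (ledger M j).raise n m W p D ∧ AgreeOff j M M' ∧ M'.Small B by
    obtain ⟨M', hrun, h1, h2, h3⟩ := this
    have hnext : next.run M' = M'.write index 0 0 (j + 1) := by
      simp [next, Prog.run, Expr.eval, (h.of_agreeOff h2).index_eq]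
    have hl : ∀ i, ledger (M'.write index 0 0 (j + 1)) i = ledger M' i := by
      intro i
      simp [ledger, Mem.write_of_ne]
    rw [hrun, hnext]
    refine ⟨(hl j).trans h1, fun i hi => (hl i).trans (h2.ledger_eq i hi),
      fun a e1 e2 e3 e4 e5 e6 => ?_, ?_, h3.write _ _ _ hj⟩
    · rw [Mem.write_of_ne e6, h2.eq a e1 e2 e3 e4 e5]
    · simp [Mem.write]
  obtain ⟨h1, a1⟩ := run_saveProg h
  have s1 := small_saveProg h hS (hD.trans_lt hW)
  have r1 := h.of_agreeOff a1
  have hv1 := hv.save hD hp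
  unfold Ledger.raise
  by_cases hc : ((ledger M j).save n p D).credit (((ledger M j).save n p D).cell n p) = W
  · have hcond : (eq (record credits) (entry weights)).eval (saveProg.run M) ≠ 0 := by
      rw [Expr.eval, eval_record r1, eval_entry r1, r1.weight_eq, if_pos]
      · exact one_ne_zero
      · rw [h1]
        rw [← hc, ← h1]
        rfl
    rw [if_pos hc]
    by_cases hu : (ledger M j).used = m
    · have hcond' : (eq (entry useds) capacity).eval (saveProg.run M) ≠ 0 := by
        have : (saveProg.run M) useds j 0 = m := (congrArg Ledger.used h1).trans hu
        simp [Expr.eval, r1.index_eq, r1.capacity_eq, this]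
      obtain ⟨h2, a2⟩ := run_flushProg r1
      have s2 := small_flushProg r1 s1 (by rw [h1]; have := hv1.epoch_le; omega) hW
      have r2 := r1.of_agreeOff a2
      obtain ⟨h3, a3⟩ := run_placeProg r2
      have s3 := small_placeProg r2 s2 (by rw [h2]; simp only [Ledger.flush]; omega) (by omega)
      refine ⟨_, ?_, ?_, (a1.trans a2).trans a3, s3⟩
      · rw [raiseProg, Prog.run, Prog.run, Prog.run, if_pos hcond, Prog.run, Prog.run, if_pos hcond']
      · rw [if_pos hu, h3, h2, h1]
    · have hcond' : ¬ (eq (entry useds) capacity).eval (saveProg.run M) ≠ 0 := by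
        have : (saveProg.run M) useds j 0 = (ledger M j).used := congrArg Ledger.used h1
        simp [Expr.eval, r1.index_eq, r1.capacity_eq, this, hu]
      obtain ⟨h3, a3⟩ := run_placeProg r1
      have s3 := small_placeProg r1 s1 (by
        rw [h1]
        have : (ledger M j).used < m := lt_of_le_of_ne hv.used_le hu
        exact lt_of_le_of_lt this hmB) (by omega)
      refine ⟨_, ?_, ?_, a1.trans a3, s3⟩
      · rw [raiseProg, Prog.run, Prog.run, Prog.run, if_pos hcond, Prog.run, Prog.run,
          if_neg hcond', Prog.run]
      · rw [if_neg hu, h3, h1]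
  · have hcond : ¬ (eq (record credits) (entry weights)).eval (saveProg.run M) ≠ 0 := by
      rw [Expr.eval, eval_record r1, eval_entry r1, r1.weight_eq, if_neg]
      · simp
      · rw [h1]
        rw [← h1] at hc
        rw [← h1]
        exact hc
    refine ⟨_, ?_, ?_, a1, s1⟩
    · rw [raiseProg, Prog.run, Prog.run, Prog.run, if_neg hcond, Prog.run]
    · rw [if_neg hc, h1]

end

variable {I : Instance} {B t : ℕ} {M : Mem}

/-- The memory between two runs of the program, after `t` requests. -/
structure Prepared (I : Instance) (t B : ℕ) (M : Mem) : Prop where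
  points_eq : M .points 0 0 = I.n
  classes_eq : M .classes 0 0 = I.ℓ
  count_eq : ∀ j : Fin I.ℓ, M .count j 0 = I.k j
  weight_eq : ∀ j : Fin I.ℓ, M weights j 0 = I.weight j
  valid : ∀ j : Fin I.ℓ, (ledger M j).Valid I.n (I.k j) (I.augCount j) (I.weight j) t
  small : M.Small B

/-- `Prepared` depends on a part of the memory only. -/
theorem Prepared.congr {M' : Mem} (h : Prepared I t B M)
    (h' : ∀ a, a ≠ .request → a ≠ index → a ≠ found → a ≠ gap → M' a = M a) (hS : M'.Small B) :
    Prepared I t B M' ∧ ∀ j, ledger M' j = ledger M j := by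
  have hl : ∀ j, ledger M' j = ledger M j := by
    intro j
    simp only [ledger]
    rw [h' credits, h' covers, h' epochs, h' useds, h' .position] <;> simp
  refine ⟨⟨?_, ?_, fun j => ?_, fun j => ?_, fun j => ?_, hS⟩, hl⟩
  · rw [h' .points (by simp) (by simp) (by simp) (by simp), h.points_eq]
  · rw [h' .classes (by simp) (by simp) (by simp) (by simp), h.classes_eq]
  · rw [h' .count (by simp) (by simp) (by simp) (by simp), h.count_eq]
  · rw [h' weights (by simp) (by simp) (by simp) (by simp), h.weight_eq]
  · rw [hl]
    exact h.valid j

theorem iterate_raiseProg (h : Prepared I t B M) (hB : I.Fits B) (ht : t + 1 < 2 ^ B)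
    (p : Fin I.n) (hp : M .request 0 0 = p) (hi : M index 0 0 = 0)
    (hD : ∀ j : Fin I.ℓ,
      (ledger M j).credit ((ledger M j).cell I.n p) + M gap 0 0 ≤ I.weight j)
    (i : ℕ) (hiℓ : i ≤ I.ℓ) :
    (∀ j : Fin I.ℓ, ledger (raiseProg.run^[i] M) j = if j < i then
        (ledger M j).raise I.n (I.augCount j) (I.weight j) p (M gap 0 0) else ledger M j) ∧
      (∀ a, a ≠ credits → a ≠ covers → a ≠ epochs → a ≠ useds → a ≠ .position → a ≠ index →
        raiseProg.run^[i] M a = M a) ∧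
      raiseProg.run^[i] M index 0 0 = i ∧ (raiseProg.run^[i] M).Small B := by
  induction i with
  | zero => simp [hi, h.small]
  | succ i ih =>
    obtain ⟨h1, h2, h3, h4⟩ := ih (Nat.le_of_succ_le hiℓ)
    rw [Function.iterate_succ_apply']
    set M' := raiseProg.run^[i] M
    have e (a : Arr) (ha : a = .points ∨ a = .classes ∨ a = .request ∨ a = gap ∨ a = weights ∨
        a = .count) : M' a = M a := by
      apply h2 <;> (rintro rfl; simp at ha)
    have hl : ledger M' i = ledger M i := by simpa using h1 ⟨i, hiℓ⟩
    have hr : Ready I.n (I.augCount ⟨i, hiℓ⟩) (I.weight ⟨i, hiℓ⟩) p (M gap 0 0) i M' := by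
      refine ⟨h3, ?_, ?_, ?_, ?_, ?_⟩
      · rw [e _ (by simp), h.points_eq]
      · rw [e _ (by simp), hp]
      · rw [e _ (by simp)]
      · rw [e _ (by simp)]
        exact h.weight_eq ⟨i, hiℓ⟩
      · rw [e .classes (by simp), e .count (by simp), h.classes_eq]
        exact congrArg _ (h.count_eq ⟨i, hiℓ⟩)
    obtain ⟨r1, r2, r3, r4, r5⟩ := run_raiseProg hr
      (by rw [hl]; exact h.valid ⟨i, hiℓ⟩) p.2 (by rw [hl]; exact hD ⟨i, hiℓ⟩) h4 hB.n_lt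
      (hB.augCount_lt _) (hB.weight_lt _) ht (lt_of_le_of_lt hiℓ hB.ℓ_lt)
    refine ⟨fun j => ?_, fun a a1 a2 a3 a4 a5 a6 => ?_, r4, r5⟩
    · by_cases hj : (j : ℕ) = i
      · have hj' : j = ⟨i, hiℓ⟩ := Fin.ext hj
        subst hj'
        rw [if_pos (Nat.lt_succ_self _)]
        exact r1.trans (by rw [hl])
      · rw [r2 _ hj, h1]
        exact if_congr (by omega) rfl rfl
    · rw [r3 a a1 a2 a3 a4 a5 a6, h2 a a1 a2 a3 a4 a5 a6]

theorem iterate_scanProg (h : Prepared I t B M) (hB : I.Fits B)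
    (p : Fin I.n) (hp : M .request 0 0 = p) (hi : M index 0 0 = 0) (hf : M found 0 0 = 0)
    (hg : M gap 0 0 = M weights 0 0) (i : ℕ) (hiℓ : i ≤ I.ℓ) :
    (∀ a, a ≠ index → a ≠ found → a ≠ gap → scanProg.run^[i] M a = M a) ∧
      scanProg.run^[i] M index 0 0 = i ∧
      (scanProg.run^[i] M found 0 0 ≠ 0 ↔
        ∃ j < i, (ledger M j).cover ((ledger M j).cell I.n p) ≠ 0) ∧
      (∀ j < i, scanProg.run^[i] M gap 0 0 ≤
        M weights j 0 - (ledger M j).credit ((ledger M j).cell I.n p)) ∧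
      (if i = 0 then scanProg.run^[i] M gap 0 0 = M weights 0 0 else
        ∃ j < i, scanProg.run^[i] M gap 0 0 =
          M weights j 0 - (ledger M j).credit ((ledger M j).cell I.n p)) ∧
      (scanProg.run^[i] M).Small B := by
  induction i with
  | zero => simp [hi, hf, hg, h.small]
  | succ i ih =>
    obtain ⟨h1, h2, h3, h4, h5, h6⟩ := ih (Nat.le_of_succ_le hiℓ)
    rw [Function.iterate_succ_apply']
    set M' := scanProg.run^[i] M
    have e (a : Arr) (ha : a = .points ∨ a = .request ∨ a = weights ∨ a = credits ∨ a = covers ∨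
        a = epochs) : M' a = M a := by
      apply h1 <;> (rintro rfl; simp at ha)
    set x := (ledger M i).cell I.n p
    have hrun : scanProg.run M' = ((M'.write found 0 0
        (if 0 < M' found 0 0 + M covers i x then 1 else 0)).write gap 0 0
        (M' gap 0 0 - (M' gap 0 0 - (M weights i 0 - M credits i x)))).write index 0 0 (i + 1) := by
      simp [scanProg, next, Prog.run, Expr.eval, Mem.write_of_ne, h2, x, ledger, Ledger.cell,
        e .points, e .request, e weights, e credits, e covers, e epochs, h.points_eq, hp]
    have hmin : ∀ a b : ℕ, a - (a - b) = min a b := by omega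
    rw [hmin] at hrun
    have hgap : scanProg.run M' gap 0 0 = min (M' gap 0 0) (M weights i 0 - M credits i x) := by
      rw [hrun]; simp [Mem.write]
    have hfound : scanProg.run M' found 0 0 =
        if 0 < M' found 0 0 + M covers i x then 1 else 0 := by
      rw [hrun]; simp [Mem.write]
    have h1B : 1 < 2 ^ B := lt_of_le_of_lt I.ℓ_pos hB.ℓ_lt
    refine ⟨fun a a1 a2 a3 => ?_, ?_, ?_, fun j hj => ?_, ?_, ?_⟩
    · rw [hrun, Mem.write_of_ne a1, Mem.write_of_ne a3, Mem.write_of_ne a2, h1 a a1 a2 a3]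
    · rw [hrun]; simp [Mem.write]
    · rw [hfound, Nat.exists_lt_succ_right, ← h3]
      change _ ↔ _ ∨ M covers i x ≠ 0
      split_ifs <;> omega
    · rw [hgap]
      rcases Nat.lt_succ_iff_lt_or_eq.1 hj with hj | rfl
      · exact (min_le_left _ _).trans (h4 j hj)
      · exact min_le_right _ _
    · rw [if_neg (Nat.succ_ne_zero i), hgap]
      by_cases hi0 : i = 0
      · rw [if_pos hi0] at h5
        refine ⟨i, Nat.lt_succ_self i, ?_⟩
        rw [h5, min_eq_right]
        · rfl
        · rw [hi0]; exact Nat.sub_le _ _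
      · rw [if_neg hi0] at h5
        obtain ⟨j, hj, hj'⟩ := h5
        rcases min_choice (M' gap 0 0) (M weights i 0 - M credits i x) with hm | hm
        · exact ⟨j, Nat.lt_succ_of_lt hj, by rw [hm, hj']⟩
        · exact ⟨i, Nat.lt_succ_self i, hm⟩
    · rw [hrun]
      refine ((h6.write _ _ _ ?_).write _ _ _ ?_).write _ _ _ (lt_of_le_of_lt hiℓ hB.ℓ_lt)
      · split_ifs <;> omega
      · exact (min_le_left _ _).trans_lt (h6 _ _ _)

/-- The preparation of the scan of the classes. -/
theorem run_serve_init (h : Prepared I t B M) (p : Fin I.n) (hp : M .request 0 0 = p) :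
    ∃ M' : Mem, M' = serveInit.run M ∧ Prepared I t B M' ∧ (∀ j, ledger M' j = ledger M j) ∧
      M' .request 0 0 = p ∧ M' index 0 0 = 0 ∧ M' found 0 0 = 0 ∧
      M' gap 0 0 = M' weights 0 0 := by
  have hrun : serveInit.run M =
      ((M.write index 0 0 0).write found 0 0 0).write gap 0 0 (M weights 0 0) := by
    simp [serveInit, Prog.run, Expr.eval, Mem.write_of_ne, Mem.write_row_self]
  have hpos : (0 : ℕ) < 2 ^ B := Nat.two_pow_pos B
  obtain ⟨h1, h2⟩ := h.congr (M' := serveInit.run M) (fun a a1 a2 a3 a4 => by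
    rw [hrun, Mem.write_of_ne a4, Mem.write_of_ne a3, Mem.write_of_ne a2]) (by
    rw [hrun]
    exact ((h.small.write _ _ _ hpos).write _ _ _ hpos).write _ _ _ (h.small _ _ _))
  refine ⟨_, rfl, h1, h2, ?_, ?_, ?_, ?_⟩ <;> rw [hrun] <;> simp [Mem.write, hp]

/-- The time of `serve`, up to the length of the numbers and the number of classes. -/
def serveEffort : ℕ :=
  serveInit.effort + scanProg.effort + raiseProg.effort + (setScalar index (lit 0)).effort +
    2 * (scalar .classes).effort + (scalar found).effort + 7

/-- The effect of `serve`: nothing happens if the request is covered; otherwise its credit is raised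
in all classes by the largest possible amount. -/
theorem run_serve (h : Prepared I t B M) (hB : I.Fits B) (ht : t + 1 < 2 ^ B)
    (p : Fin I.n) (hp : M .request 0 0 = p) :
    Prepared I (t + 1) B (serve.run M) ∧
    serve.steps M ≤ serveEffort * ((B + 1) * (I.ℓ + 1)) ∧
    (((∃ j : Fin I.ℓ, (ledger M j).cover ((ledger M j).cell I.n p) ≠ 0) ∧
        ∀ j : Fin I.ℓ, ledger (serve.run M) j = ledger M j) ∨
      ∃ D, (∀ j : Fin I.ℓ, (ledger M j).cover ((ledger M j).cell I.n p) = 0 ∧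
          (ledger M j).credit ((ledger M j).cell I.n p) + D ≤ I.weight j ∧
          ledger (serve.run M) j =
            (ledger M j).raise I.n (I.augCount j) (I.weight j) p D) ∧
        ∃ j : Fin I.ℓ, (ledger M j).credit ((ledger M j).cell I.n p) + D = I.weight j) := by
  obtain ⟨M₀, hM₀, h₀, l₀, p₀, i₀, f₀, g₀⟩ := run_serve_init h p hp
  have hscan := iterate_scanProg h₀ hB p p₀ i₀ f₀ g₀
  obtain ⟨a1, a2, a3, a4, a5, a6⟩ := hscan I.ℓ le_rfl
  rw [if_neg I.ℓ_pos.ne'] at a5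
  set M₁ := scanProg.run^[I.ℓ] M₀ with hM₁
  set M₂ := M₁.write index 0 0 0 with hM₂
  have hS₂ : M₂.Small B := a6.write _ _ _ (Nat.two_pow_pos B)
  obtain ⟨h₂, l₂⟩ := h₀.congr (M' := M₂) (fun a b1 b2 b3 b4 => by
    rw [hM₂, Mem.write_of_ne b2, a1 a b2 b3 b4]) hS₂
  have p₂ : M₂ .request 0 0 = p := by
    rw [hM₂, Mem.write_of_ne (by simp), a1 _ (by simp) (by simp) (by simp), p₀]
  have g₂ : M₂ gap 0 0 = M₁ gap 0 0 := by
    rw [hM₂, Mem.write_of_ne (by simp)]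
  have f₂ : M₂ found 0 0 = M₁ found 0 0 := by
    rw [hM₂, Mem.write_of_ne (by simp)]
  have i₂ : M₂ index 0 0 = 0 := by
    simp [hM₂, Mem.write]
  -- The intermediate memories, and the time of the parts of the program.
  have e₁ : (loop (scalar .classes) scanProg).run M₀ = M₁ := by
    simp [Prog.run, Expr.eval, h₀.classes_eq, hM₁]
  have e₂ : (setScalar index (lit 0)).run M₁ = M₂ := by
    simp [Prog.run, Expr.eval, hM₂]
  have hZ : B + 1 ≤ (B + 1) * (I.ℓ + 1) := Nat.le_mul_of_pos_right _ (Nat.succ_pos _)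
  have t₀ : serveInit.steps M ≤ serveInit.effort * ((B + 1) * (I.ℓ + 1)) :=
    (steps_le_of_loopFree (by simp [serveInit, LoopFree]) h.small).trans (Nat.mul_le_mul_left _ hZ)
  have t₁ : (loop (scalar .classes) scanProg).steps M₀ ≤
      ((scalar .classes).effort + scanProg.effort + 2) * ((B + 1) * (I.ℓ + 1)) := by
    have hev : (scalar .classes).eval M₀ = I.ℓ := by simp [Expr.eval, h₀.classes_eq]
    rw [← hev]
    refine steps_loop_le_of_loopFree (by simp [scanProg, next, LoopFree]) h₀.small fun i hi => ?_
    rw [hev] at hi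
    exact (hscan i hi.le).2.2.2.2.2
  have t₂ : (setScalar index (lit 0)).steps M₁ ≤
      (setScalar index (lit 0)).effort * ((B + 1) * (I.ℓ + 1)) :=
    (steps_le_of_loopFree (by simp [LoopFree]) a6).trans (Nat.mul_le_mul_left _ hZ)
  have hcost := ((scalar found).cost_le hS₂).trans (Nat.mul_le_mul_left _ hZ)
  have hrun : serve.run M =
      if M₂ found 0 0 ≠ 0 then M₂ else (loop (scalar .classes) raiseProg).run M₂ := by
    rw [serve, run_seq, ← hM₀, run_seq, e₁, run_seq, e₂]
    rfl
  have hsteps : serve.steps M = serveInit.steps M + ((loop (scalar .classes) scanProg).steps M₀ +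
      ((setScalar index (lit 0)).steps M₁ + ((scalar found).cost M₂ + 1 +
        if M₂ found 0 0 ≠ 0 then 1 else (loop (scalar .classes) raiseProg).steps M₂))) := by
    rw [serve, steps_seq, ← hM₀, steps_seq, e₁, steps_seq, e₂, steps_ite]
    rfl
  by_cases hf : M₂ found 0 0 ≠ 0
  · rw [if_pos hf] at hrun hsteps
    obtain ⟨j, hj, hj'⟩ := a3.1 (f₂ ▸ hf)
    refine ⟨?_, ?_, Or.inl ⟨⟨⟨j, hj⟩, ?_⟩, fun j => ?_⟩⟩
    · rw [hrun]
      exact { h₂ with valid := fun j => (h₂.valid j).mono (Nat.le_succ t) }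
    · rw [hsteps]
      have : 0 ≤ raiseProg.effort * ((B + 1) * (I.ℓ + 1)) := Nat.zero_le _
      simp only [serveEffort, add_mul, two_mul] at *
      omega
    · simpa [l₀] using hj'
    · rw [hrun, l₂, l₀]
  · rw [if_neg hf] at hrun hsteps
    have hcov : ∀ j : Fin I.ℓ, (ledger M j).cover ((ledger M j).cell I.n p) = 0 := by
      intro j
      by_contra hne
      exact hf (f₂ ▸ a3.2 ⟨j, j.2, by rwa [l₀]⟩)
    have hle : ∀ j : Fin I.ℓ,
        (ledger M j).credit ((ledger M j).cell I.n p) + M₂ gap 0 0 ≤ I.weight j := by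
      intro j
      have b1 := a4 j j.2
      have b2 := (h.valid j).credit_le p p.2
      rw [h₀.weight_eq, l₀, ← g₂] at b1
      omega
    have hraise := iterate_raiseProg h₂ hB ht p p₂ i₂ (fun j => by rw [l₂, l₀]; exact hle j)
    have hev : (scalar .classes).eval M₂ = I.ℓ := by simp [Expr.eval, h₂.classes_eq]
    have t₃ : (loop (scalar .classes) raiseProg).steps M₂ ≤
        ((scalar .classes).effort + raiseProg.effort + 2) * ((B + 1) * (I.ℓ + 1)) := by
      rw [← hev]
      refine steps_loop_le_of_loopFree
        (by simp [raiseProg, saveProg, flushProg, placeProg, next, LoopFree]) hS₂ fun i hi => ?_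
      rw [hev] at hi
      exact (hraise i hi.le).2.2.2
    rw [Prog.run, hev] at hrun
    obtain ⟨r1, r2, r3, r4⟩ := hraise I.ℓ le_rfl
    rw [← hrun] at r1 r2 r3 r4
    have hl : ∀ j : Fin I.ℓ, ledger (serve.run M) j =
        (ledger M j).raise I.n (I.augCount j) (I.weight j) p (M₂ gap 0 0) := by
      intro j
      rw [r1, if_pos j.2, l₂, l₀]
    refine ⟨⟨?_, ?_, fun j => ?_, fun j => ?_, fun j => ?_, r4⟩, ?_,
      Or.inr ⟨M₂ gap 0 0, fun j => ⟨hcov j, hle j, hl j⟩, ?_⟩⟩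
    · rw [r2 .points (by simp) (by simp) (by simp) (by simp) (by simp) (by simp), h₂.points_eq]
    · rw [r2 .classes (by simp) (by simp) (by simp) (by simp) (by simp) (by simp), h₂.classes_eq]
    · rw [r2 .count (by simp) (by simp) (by simp) (by simp) (by simp) (by simp), h₂.count_eq]
    · rw [r2 weights (by simp) (by simp) (by simp) (by simp) (by simp) (by simp), h₂.weight_eq]
    · rw [hl]
      exact (h.valid j).raise (I.augCount_pos j) (hle j) p.2
    · rw [hsteps]
      simp only [serveEffort, add_mul, two_mul] at *
      omega
    · obtain ⟨j, hj, hj'⟩ := a5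
      refine ⟨⟨j, hj⟩, ?_⟩
      have b2 := (h.valid ⟨j, hj⟩).credit_le p p.2
      have b3 : M₀ weights j 0 = I.weight ⟨j, hj⟩ := h₀.weight_eq ⟨j, hj⟩
      rw [b3, l₀, ← g₂] at hj'
      dsimp only at b2 ⊢
      omega

end Algorithm

namespace Instance

variable {I : Instance} {B : ℕ}

theorem denom_pos (I : Instance) : 0 < I.denom := Finset.prod_pos fun j _ => (I.W j).den_pos

theorem den_dvd_denom (I : Instance) (j : Fin I.ℓ) : (I.W j).den ∣ I.denom :=
  Finset.dvd_prod_of_mem (fun j => (I.W j).den) (Finset.mem_univ j)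

theorem Fits.one_lt (h : I.Fits B) : 1 < 2 ^ B := lt_of_le_of_lt I.ℓ_pos h.ℓ_lt

theorem Fits.den_lt (h : I.Fits B) (j : Fin I.ℓ) : (I.W j).den < 2 ^ B :=
  (Nat.le_of_dvd I.denom_pos (I.den_dvd_denom j)).trans_lt h.denom_lt

theorem Fits.num_lt (h : I.Fits B) (j : Fin I.ℓ) : (I.W j).num < 2 ^ B :=
  (Nat.le_mul_of_pos_right _ (Nat.div_pos (Nat.le_of_dvd I.denom_pos (I.den_dvd_denom j))
    (I.W j).den_pos)).trans_lt (h.weight_lt j)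

theorem k_le_augCount (I : Instance) (j : Fin I.ℓ) : I.k j ≤ I.augCount j :=
  Nat.le_mul_of_pos_left _ (Nat.mul_pos two_pos I.ℓ_pos)

theorem Fits.k_lt (h : I.Fits B) (j : Fin I.ℓ) : I.k j < 2 ^ B :=
  (I.k_le_augCount j).trans_lt (h.augCount_lt j)

theorem Fits.small_inputMem (h : I.Fits B) : I.inputMem.Small B := by
  intro a i j
  have h0 : (0 : ℕ) < 2 ^ B := Nat.two_pow_pos B
  cases a <;> simp only [inputMem]
  · split_ifs <;> first | exact h0 | exact h.n_lt
  · split_ifs <;> first | exact h0 | exact h.ℓ_lt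
  · split_ifs <;> first | exact h0 | exact h.k_lt _
  · split_ifs <;> first | exact h0 | exact h.num_lt _
  · split_ifs <;> first | exact h0 | exact h.den_lt _
  · split_ifs <;> first | exact h0 | exact (I.init _ _).2.trans h.n_lt
  all_goals exact h0

end Instance

namespace Algorithm

open WeightedKServer.Expr WeightedKServer.Prog

/-! ### The initialization -/

variable {I : Instance} {B t : ℕ} {M : Mem}

theorem iterate_slotProg {j : ℕ} (hS : M.Small B) (hj : M index 0 0 = j) (hs : M slot 0 0 = 0)
    {m : ℕ} (hm : m < 2 ^ B) (hB : 1 < 2 ^ B) (i : ℕ) (hi : i ≤ m) :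
    (∀ x, x ≠ j → ledger (slotProg.run^[i] M) x = ledger M x) ∧
    (∀ a, a ≠ .position → a ≠ credits → a ≠ covers → a ≠ slot →
      slotProg.run^[i] M a = M a) ∧
    slotProg.run^[i] M slot 0 0 = i ∧
    (∀ s, slotProg.run^[i] M .position j s =
      if s < i then M .start j (s % M .count j 0) else M .position j s) ∧
    (∀ q, slotProg.run^[i] M credits j q =
      if ∃ s < i, M .start j (s % M .count j 0) = q then M weights j 0 else M credits j q) ∧
    (∀ q, slotProg.run^[i] M covers j q =
      if ∃ s < i, M .start j (s % M .count j 0) = q then 1 else M covers j q) ∧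
    (slotProg.run^[i] M).Small B := by
  induction i with
  | zero => simp [hs, hS]
  | succ i ih =>
    obtain ⟨h1, h2, h3, h4, h5, h6, h7⟩ := ih (Nat.le_of_succ_le hi)
    rw [Function.iterate_succ_apply']
    set M' := slotProg.run^[i] M
    set x := M .start j (i % M .count j 0) with hx
    have hrun : slotProg.run M' = (((M'.write .position j i x).write credits j x
        (M weights j 0)).write covers j x 1).write slot 0 0 (i + 1) := by
      simp [slotProg, Prog.run, Expr.eval, Mem.write_of_ne, Mem.write_row_self, h3,
        h2 index, h2 .start, h2 .count, h2 weights, hj, x, Nat.mod_eq_sub_div_mul]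
    rw [hrun]
    refine ⟨fun y hy => ?_, fun a a1 a2 a3 a4 => ?_, ?_, fun s => ?_, fun q => ?_, fun q => ?_, ?_⟩
    · rw [← h1 y hy]
      simp [ledger, Mem.write_of_ne, Mem.write_row_of_ne hy]
    · rw [Mem.write_of_ne a4, Mem.write_of_ne a3, Mem.write_of_ne a2, Mem.write_of_ne a1,
        h2 a a1 a2 a3 a4]
    · simp [Mem.write]
    · simp only [Mem.write_of_ne, ne_eq, reduceCtorEq, not_false_eq_true, Mem.write_row_self,
        Function.update_apply, h4]
      by_cases hsi : s = i
      · simp [hsi, hx]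
      · simp only [hsi, if_false]
        exact if_congr (by omega) rfl rfl
    · simp only [Mem.write_of_ne, ne_eq, reduceCtorEq, not_false_eq_true, Mem.write_row_self,
        Function.update_apply, h5, Arr.work.injEq, Nat.exists_lt_succ_right]
      by_cases hq : q = x
      · simp [hq, ← hx]
      · simp [hq, Ne.symm hq, ← hx]
    · simp only [Mem.write_of_ne, ne_eq, reduceCtorEq, not_false_eq_true, Mem.write_row_self,
        Function.update_apply, h6, Arr.work.injEq, Nat.reduceEqDiff, Nat.exists_lt_succ_right]
      by_cases hq : q = x
      · simp [hq, ← hx]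
      · simp [hq, Ne.symm hq, ← hx]
    · exact (((h7.write _ _ _ (hS _ _ _)).write _ _ _ (hS _ _ _)).write _ _ _ hB).write _ _ _
        (lt_of_le_of_lt hi hm)

/-- The initialization of a class. -/
def initProg : Prog := classProg.seq ((loop capacity slotProg).seq next)

/-- The time of the initialization of a class, up to the length of the numbers and the number of
servers. -/
def initEffort : ℕ :=
  classProg.effort + capacity.effort + slotProg.effort + next.effort + 2

theorem run_initProg (hB : I.Fits B) (hS : M.Small B) {j : Fin I.ℓ}
    (hin : ∀ a, a = .classes ∨ a = .count ∨ a = .num ∨ a = .den ∨ a = .start →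
      M a = I.inputMem a) (hj : M index 0 0 = j) (hd : M denom 0 0 = I.denom)
    (hl : ledger M j = ⟨0, 0, 0, 0, 0⟩) :
    (∀ i, i ≠ (j : ℕ) → ledger (initProg.run M) i = ledger M i ∧
      initProg.run M weights i = M weights i) ∧
    (∀ a, a ≠ .position → a ≠ credits → a ≠ covers → a ≠ slot → a ≠ useds → a ≠ weights →
      a ≠ index → initProg.run M a = M a) ∧
    initProg.run M index 0 0 = j + 1 ∧
    initProg.run M weights j 0 = I.weight j ∧
    (ledger (initProg.run M) j).Initial I.n (I.k j) (I.augCount j) (I.weight j)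
      (I.inputMem .start j) ∧
    (initProg.run M).Small B ∧
    initProg.steps M ≤ initEffort * ((B + 1) * (I.augCount j + 1)) := by
  have hk : M .count j 0 = I.k j := by
    rw [hin _ (by simp)]; simp [Instance.inputMem]
  have hst : M .start j = I.inputMem .start j := by
    rw [hin _ (by simp)]
  have hrun₁ : classProg.run M = ((M.write weights j 0 (I.weight j)).write useds j 0
      (I.k j)).write slot 0 0 0 := by
    have h1 : M .num j 0 = (I.W j).num := by
      rw [hin _ (by simp)]; simp [Instance.inputMem]
    have h2 : M .den j 0 = (I.W j).den := by
      rw [hin _ (by simp)]; simp [Instance.inputMem]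
    simp [classProg, Prog.run, Expr.eval, Mem.write_of_ne, hj, hd, h1, h2, hk, Instance.weight]
  set M₁ := classProg.run M
  have hS₁ : M₁.Small B := by
    rw [hrun₁]
    exact ((hS.write _ _ _ (hB.weight_lt j)).write _ _ _ (hB.k_lt j)).write _ _ _
      (Nat.two_pow_pos B)
  have e₁ : ∀ a, a ≠ weights → a ≠ useds → a ≠ slot → M₁ a = M a := by
    intro a a1 a2 a3
    rw [hrun₁, Mem.write_of_ne a3, Mem.write_of_ne a2, Mem.write_of_ne a1]
  have hj₁ : M₁ index 0 0 = j := by rw [e₁ _ (by simp) (by simp) (by simp), hj]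
  have hs₁ : M₁ slot 0 0 = 0 := by rw [hrun₁]; simp [Mem.write]
  have hw₁ : M₁ weights j 0 = I.weight j := by rw [hrun₁]; simp [Mem.write]
  have hk₁ : M₁ .count j 0 = I.k j := by rw [e₁ _ (by simp) (by simp) (by simp), hk]
  have hst₁ : M₁ .start j = I.inputMem .start j := by
    rw [e₁ _ (by simp) (by simp) (by simp), hst]
  have hev : capacity.eval M₁ = I.augCount j := by
    have : M₁ .classes 0 0 = I.ℓ := by
      rw [e₁ _ (by simp) (by simp) (by simp), hin _ (by simp)]
      simp [Instance.inputMem]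
    simp [Expr.eval, hj₁, this, hk₁, Instance.augCount]
  have hslot := iterate_slotProg hS₁ hj₁ hs₁ (hB.augCount_lt j) hB.one_lt
  obtain ⟨h1, h2, h3, h4, h5, h6, h7⟩ := hslot _ le_rfl
  rw [hw₁, hk₁, hst₁] at h5
  rw [hk₁, hst₁] at h4 h6
  set M₂ := slotProg.run^[I.augCount j] M₁ with hM₂
  have hrun : initProg.run M = M₂.write index 0 0 (j + 1) := by
    have : (loop capacity slotProg).run M₁ = M₂ := by rw [Prog.run, hev]
    rw [initProg, run_seq, run_seq, this]
    simp [next, Prog.run, Expr.eval, h2 index, hj₁]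
  have hl₂ : ∀ i, ledger (M₂.write index 0 0 (j + 1)) i = ledger M₂ i := by
    intro i
    simp [ledger, Mem.write_of_ne]
  -- The positions of the first `k` slots are repeated.
  have hmod : ∀ q, (∃ s < I.augCount j, I.inputMem .start j (s % I.k j) = q) ↔
      ∃ i < I.k j, I.inputMem .start j i = q := by
    intro q
    constructor
    · rintro ⟨s, -, hs⟩
      exact ⟨_, Nat.mod_lt _ (I.k_pos j), hs⟩
    · rintro ⟨i, hi, hq⟩
      exact ⟨i, hi.trans_le (I.k_le_augCount j), by rw [Nat.mod_eq_of_lt hi, hq]⟩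
  have hM₁ : ∀ a, a ≠ weights → a ≠ useds → a ≠ slot → M₁ a j = M a j :=
    fun a a1 a2 a3 => by rw [e₁ a a1 a2 a3]
  rw [hrun]
  refine ⟨fun i hi => ⟨?_, ?_⟩, fun a a1 a2 a3 a4 a5 a6 a7 => ?_, ?_, ?_, ?_, ?_, ?_⟩
  · rw [hl₂, h1 i hi, hrun₁]
    simp [ledger, Mem.write_of_ne, Mem.write_row_of_ne hi]
  · rw [Mem.write_of_ne (by simp), h2 _ (by simp) (by simp) (by simp) (by simp), hrun₁,
      Mem.write_of_ne (by simp), Mem.write_of_ne (by simp), Mem.write_row_of_ne hi]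
  · rw [Mem.write_of_ne a7, h2 a a1 a2 a3 a4, e₁ a a6 a5 a4]
  · simp [Mem.write]
  · rw [Mem.write_of_ne (by simp), h2 _ (by simp) (by simp) (by simp) (by simp), hw₁]
  · rw [hl₂]
    have hstart : ∀ i, I.inputMem .start j i < I.n := by
      intro i
      simp only [Instance.inputMem]
      split_ifs <;> first | exact I.n_pos | exact (I.init _ _).2
    have hpos : ∀ s, M₁ .position j s = 0 := fun s =>
      (congrFun (hM₁ .position (by simp) (by simp) (by simp)) s).trans
        (congrFun (congrArg Ledger.pos hl) s)
    have hcr : ∀ s, M₁ credits j s = 0 := fun s =>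
      (congrFun (hM₁ credits (by simp) (by simp) (by simp)) s).trans
        (congrFun (congrArg Ledger.credit hl) s)
    have hco : ∀ s, M₁ covers j s = 0 := fun s =>
      (congrFun (hM₁ covers (by simp) (by simp) (by simp)) s).trans
        (congrFun (congrArg Ledger.cover hl) s)
    refine ⟨?_, ?_, fun i hi => ?_, fun i => ?_, fun q => ?_, fun q => ?_⟩
    · change M₂ epochs j 0 = 0
      rw [h2 _ (by simp) (by simp) (by simp) (by simp), e₁ _ (by simp) (by simp) (by simp)]
      exact congrArg Ledger.epoch hl
    · change M₂ useds j 0 = _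
      rw [h2 _ (by simp) (by simp) (by simp) (by simp), hrun₁]
      simp [Mem.write]
    · exact (h4 i).trans (if_pos hi)
    · refine (h4 i).trans_lt ?_
      split_ifs
      · exact hstart _
      · rw [hpos]; exact I.n_pos
    · refine (h5 q).trans ?_
      rw [hcr]
      exact if_congr (hmod q) rfl rfl
    · refine (h6 q).trans ?_
      rw [hco]
      exact if_congr (hmod q) rfl rfl
  · exact h7.write _ _ _ (lt_of_le_of_lt j.2 hB.ℓ_lt)
  · have hZ : B + 1 ≤ (B + 1) * (I.augCount j + 1) := Nat.le_mul_of_pos_right _ (Nat.succ_pos _)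
    have t₁ : classProg.steps M ≤ classProg.effort * ((B + 1) * (I.augCount j + 1)) :=
      (steps_le_of_loopFree (by simp [classProg, LoopFree]) hS).trans (Nat.mul_le_mul_left _ hZ)
    have t₂ : (loop capacity slotProg).steps M₁ ≤
        (capacity.effort + slotProg.effort + 2) * ((B + 1) * (I.augCount j + 1)) := by
      rw [← hev]
      refine steps_loop_le_of_loopFree (by simp [slotProg, LoopFree]) hS₁ fun i hi => ?_
      rw [hev] at hi
      exact (hslot i hi.le).2.2.2.2.2.2
    have t₃ : next.steps M₂ ≤ next.effort * ((B + 1) * (I.augCount j + 1)) :=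
      (steps_le_of_loopFree (by simp [next, LoopFree]) h7).trans (Nat.mul_le_mul_left _ hZ)
    have hsteps : initProg.steps M =
        classProg.steps M + ((loop capacity slotProg).steps M₁ + next.steps M₂) := by
      have : (loop capacity slotProg).run M₁ = M₂ := by rw [Prog.run, hev]
      rw [initProg, steps_seq, steps_seq, this]
    rw [hsteps]
    simp only [initEffort, add_mul, two_mul] at *
    omega

theorem iterate_denomProg (hB : I.Fits B) (hM : ∀ a, (∀ i, a ≠ .work i) → M a = I.inputMem a)
    (hS : M.Small B) (hj : M index 0 0 = 0) (hd : M denom 0 0 = 1) (i : ℕ) (hi : i ≤ I.ℓ) :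
    (∀ a, a ≠ index → a ≠ denom → denomProg.run^[i] M a = M a) ∧
      denomProg.run^[i] M index 0 0 = i ∧
      denomProg.run^[i] M denom 0 0 = ∏ j ∈ Finset.range i, I.inputMem .den j 0 ∧
      (denomProg.run^[i] M).Small B := by
  induction i with
  | zero => simp [hj, hd, hS]
  | succ i ih =>
    obtain ⟨h1, h2, h3, h4⟩ := ih (Nat.le_of_succ_le hi)
    rw [Function.iterate_succ_apply']
    set M' := denomProg.run^[i] M
    have hden : M' .den i 0 = I.inputMem .den i 0 := by
      rw [h1 _ (by simp) (by simp), hM _ (by simp)]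
    have hrun : denomProg.run M' = (M'.write denom 0 0
        (∏ j ∈ Finset.range (i + 1), I.inputMem .den j 0)).write index 0 0 (i + 1) := by
      simp [denomProg, next, Prog.run, Expr.eval, Mem.write_of_ne, h2, h3, hden,
        Finset.prod_range_succ]
    have hle : ∏ j ∈ Finset.range (i + 1), I.inputMem .den j 0 ≤ I.denom := by
      have : I.denom = ∏ j ∈ Finset.range I.ℓ, I.inputMem .den j 0 := by
        rw [Finset.prod_range]
        simp [Instance.denom, Instance.inputMem]
      rw [this]
      refine Finset.prod_le_prod_of_subset_of_one_le' (Finset.range_subset_range.2 hi)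
        fun j hj _ => ?_
      have hj' := Finset.mem_range.1 hj
      simp [Instance.inputMem, hj', Nat.one_le_iff_ne_zero]
    rw [hrun]
    refine ⟨fun a a1 a2 => ?_, ?_, ?_, ?_⟩
    · rw [Mem.write_of_ne a1, Mem.write_of_ne a2, h1 a a1 a2]
    · simp [Mem.write]
    · simp [Mem.write]
    · exact (h4.write _ _ _ (hle.trans_lt hB.denom_lt)).write _ _ _ (lt_of_le_of_lt hi hB.ℓ_lt)

theorem iterate_initProg (hB : I.Fits B) (hM : ∀ a, (∀ i, a ≠ .work i) → M a = I.inputMem a)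
    (hw : ∀ j, ledger M j = ⟨0, 0, 0, 0, 0⟩) (hS : M.Small B) (hi : M index 0 0 = 0)
    (hd : M denom 0 0 = I.denom) (i : ℕ) (hiℓ : i ≤ I.ℓ) :
    (∀ a, a ≠ .position → (∀ i, a ≠ .work i) → initProg.run^[i] M a = I.inputMem a) ∧
    (∀ j : Fin I.ℓ, (j : ℕ) < i → initProg.run^[i] M weights j 0 = I.weight j ∧
      (ledger (initProg.run^[i] M) j).Initial I.n (I.k j) (I.augCount j) (I.weight j)
        (I.inputMem .start j)) ∧
    (∀ j, i ≤ j → ledger (initProg.run^[i] M) j = ⟨0, 0, 0, 0, 0⟩) ∧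
    initProg.run^[i] M index 0 0 = i ∧ initProg.run^[i] M denom 0 0 = I.denom ∧
    (initProg.run^[i] M).Small B ∧
    ∀ hi : i < I.ℓ, initProg.steps (initProg.run^[i] M) ≤
      initEffort * ((B + 1) * (I.augCount ⟨i, hi⟩ + 1)) := by
  suffices H : (∀ a, a ≠ .position → (∀ i, a ≠ .work i) →
        initProg.run^[i] M a = I.inputMem a) ∧
      (∀ j : Fin I.ℓ, (j : ℕ) < i → initProg.run^[i] M weights j 0 = I.weight j ∧
        (ledger (initProg.run^[i] M) j).Initial I.n (I.k j) (I.augCount j) (I.weight j)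
          (I.inputMem .start j)) ∧
      (∀ j, i ≤ j → ledger (initProg.run^[i] M) j = ⟨0, 0, 0, 0, 0⟩) ∧
      initProg.run^[i] M index 0 0 = i ∧ initProg.run^[i] M denom 0 0 = I.denom ∧
      (initProg.run^[i] M).Small B by
    obtain ⟨h1, h2, h3, h4, h5, h6⟩ := H
    refine ⟨h1, h2, h3, h4, h5, h6, fun hi => ?_⟩
    exact (run_initProg hB h6 (j := ⟨i, hi⟩) (fun a ha => h1 a (by rintro rfl; simp at ha)
      (by rintro i rfl; simp at ha)) h4 h5 (h3 i le_rfl)).2.2.2.2.2.2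
  induction i with
  | zero => exact ⟨fun a _ h => hM a h, by simp, fun j _ => hw j, hi, hd, hS⟩
  | succ i ih =>
    obtain ⟨h1, h2, h3, h4, h5, h6⟩ := ih (Nat.le_of_succ_le hiℓ)
    rw [Function.iterate_succ_apply']
    set M' := initProg.run^[i] M
    obtain ⟨r1, r2, r3, r4, r5, r6, -⟩ := run_initProg hB h6 (j := ⟨i, hiℓ⟩)
      (fun a ha => h1 a (by rintro rfl; simp at ha) (by rintro i rfl; simp at ha)) h4 h5
      (h3 i le_rfl)
    refine ⟨fun a a1 a2 => ?_, fun j hj => ?_, fun j hj => ?_, r3, ?_, r6⟩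
    · rw [r2 a a1 (a2 _) (a2 _) (a2 _) (a2 _) (a2 _) (a2 _), h1 a a1 a2]
    · by_cases hji : (j : ℕ) = i
      · have hj' : j = ⟨i, hiℓ⟩ := Fin.ext hji
        subst hj'
        exact ⟨r4, r5⟩
      · rw [(r1 j hji).1, (r1 j hji).2]
        exact h2 j (by omega)
    · rw [(r1 j (by dsimp only; omega)).1]
      exact h3 j (by omega)
    · rw [r2 _ (by simp) (by simp) (by simp) (by simp) (by simp) (by simp) (by simp), h5]

/-- The time of `setup`, up to the length of the numbers and the numbers of classes and servers. -/
def setupEffort : ℕ :=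
  (setScalar denom (lit 1)).effort + ((scalar .classes).effort + denomProg.effort + 2) +
    (setScalar index (lit 0)).effort + ((scalar .classes).effort + initEffort + 2)

theorem run_setup (hB : I.Fits B) {A : ℕ} (hA : ∀ j, I.augCount j ≤ A) :
    Prepared I 0 B (setup.run I.inputMem) ∧
    (∀ j : Fin I.ℓ, (ledger (setup.run I.inputMem) j).Initial I.n (I.k j) (I.augCount j)
      (I.weight j) (I.inputMem .start j)) ∧
    setup.steps I.inputMem ≤ setupEffort * ((B + 1) * (A + 1) * (I.ℓ + 1)) := by
  have hS := hB.small_inputMem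
  set M₀ := I.inputMem.write denom 0 0 1 with hM₀
  have e₀ : (setScalar denom (lit 1)).run I.inputMem = M₀ := by
    simp [Prog.run, Expr.eval, hM₀]
  have hS₀ : M₀.Small B := hS.write _ _ _ hB.one_lt
  have h₀ : ∀ a, (∀ i, a ≠ .work i) → M₀ a = I.inputMem a := fun a ha =>
    Mem.write_of_ne (ha _) _ _ _ _
  have hden := iterate_denomProg hB h₀ hS₀ (by simp [hM₀, Mem.write, Instance.inputMem])
    (by simp [hM₀, Mem.write])
  obtain ⟨a1, a2, a3, a4⟩ := hden _ le_rfl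
  set M₁ := denomProg.run^[I.ℓ] M₀ with hM₁
  have hev₀ : (scalar .classes).eval M₀ = I.ℓ := by
    simp [Expr.eval, h₀ .classes, Instance.inputMem]
  have e₁ : (loop (scalar .classes) denomProg).run M₀ = M₁ := by
    rw [Prog.run, hev₀]
  set M₂ := M₁.write index 0 0 0 with hM₂
  have e₂ : (setScalar index (lit 0)).run M₁ = M₂ := by
    simp [Prog.run, Expr.eval, hM₂]
  have hS₂ : M₂.Small B := a4.write _ _ _ (Nat.two_pow_pos B)
  have h₂ : ∀ a, a ≠ index → a ≠ denom → M₂ a = I.inputMem a := fun a b1 b2 => by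
    rw [hM₂, Mem.write_of_ne b1, a1 a b1 b2, hM₀, Mem.write_of_ne b2]
  have hd₂ : M₂ denom 0 0 = I.denom := by
    rw [hM₂, Mem.write_of_ne (by simp), a3, Finset.prod_range]
    simp [Instance.denom, Instance.inputMem]
  have hev₂ : (scalar .classes).eval M₂ = I.ℓ := by
    simp [Expr.eval, h₂ .classes, Instance.inputMem]
  have hinit := iterate_initProg hB (M := M₂) (fun a ha => h₂ a (ha _) (ha _)) (fun j => by
    simp only [ledger]
    rw [h₂ credits, h₂ covers, h₂ epochs, h₂ useds, h₂ .position] <;> simp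
    simp [Instance.inputMem, funext_iff]) hS₂ (by simp [hM₂, Mem.write]) hd₂
  obtain ⟨b1, b2, b3, b4, b5, b6, -⟩ := hinit _ le_rfl
  have hrun : setup.run I.inputMem = initProg.run^[I.ℓ] M₂ := by
    rw [setup, run_seq, e₀, run_seq, e₁, run_seq, e₂, Prog.run, hev₂]
    rfl
  rw [hrun]
  refine ⟨⟨?_, ?_, fun j => ?_, fun j => (b2 j j.2).1, fun j => ?_, b6⟩,
    fun j => (b2 j j.2).2, ?_⟩
  · rw [b1 _ (by simp) (by simp)]; simp [Instance.inputMem]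
  · rw [b1 _ (by simp) (by simp)]; simp [Instance.inputMem]
  · rw [b1 _ (by simp) (by simp)]; simp [Instance.inputMem]
  · refine (b2 j j.2).2.valid (I.k_le_augCount j) fun i hi => ?_
    simp [Instance.inputMem, hi]
  · have hZ₁ : (B + 1) * (I.ℓ + 1) ≤ (B + 1) * (A + 1) * (I.ℓ + 1) :=
      Nat.mul_le_mul_right _ (Nat.le_mul_of_pos_right _ (Nat.succ_pos _))
    have hZ₀ : B + 1 ≤ (B + 1) * (A + 1) * (I.ℓ + 1) :=
      (Nat.le_mul_of_pos_right _ (Nat.succ_pos _)).trans hZ₁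
    have t₀ : (setScalar denom (lit 1)).steps I.inputMem ≤
        (setScalar denom (lit 1)).effort * ((B + 1) * (A + 1) * (I.ℓ + 1)) :=
      (steps_le_of_loopFree (by simp [LoopFree]) hS).trans (Nat.mul_le_mul_left _ hZ₀)
    have t₁ : (loop (scalar .classes) denomProg).steps M₀ ≤
        ((scalar .classes).effort + denomProg.effort + 2) * ((B + 1) * (A + 1) * (I.ℓ + 1)) := by
      refine le_trans ?_ (Nat.mul_le_mul_left _ hZ₁)
      rw [← hev₀]
      refine steps_loop_le_of_loopFree (by simp [denomProg, next, LoopFree]) hS₀ fun i hi => ?_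
      rw [hev₀] at hi
      exact (hden i hi.le).2.2.2
    have t₂ : (setScalar index (lit 0)).steps M₁ ≤
        (setScalar index (lit 0)).effort * ((B + 1) * (A + 1) * (I.ℓ + 1)) :=
      (steps_le_of_loopFree (by simp [LoopFree]) a4).trans (Nat.mul_le_mul_left _ hZ₀)
    have t₃ : (loop (scalar .classes) initProg).steps M₂ ≤
        ((scalar .classes).effort + initEffort + 2) * ((B + 1) * (A + 1) * (I.ℓ + 1)) := by
      have h3 := steps_loop_le (e := scalar .classes) (p := initProg)
        (τ := initEffort * ((B + 1) * (A + 1))) hS₂ fun i hi => by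
          rw [hev₂] at hi
          refine ((hinit i hi.le).2.2.2.2.2.2 hi).trans ?_
          gcongr
          exact hA _
      rw [hev₂] at h3
      have h4 : ((scalar .classes).effort + 1) * (B + 1) ≤
          ((scalar .classes).effort + 1) * ((B + 1) * (A + 1) * (I.ℓ + 1)) :=
        Nat.mul_le_mul_left _ hZ₀
      have h5 : I.ℓ * (initEffort * ((B + 1) * (A + 1)) + 1) ≤
          (I.ℓ + 1) * (initEffort * ((B + 1) * (A + 1)) + (B + 1) * (A + 1)) :=
        Nat.mul_le_mul (Nat.le_succ _) (Nat.add_le_add_left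
          (Nat.mul_pos (Nat.succ_pos _) (Nat.succ_pos _)) _)
      linarith
    have hsteps : setup.steps I.inputMem = (setScalar denom (lit 1)).steps I.inputMem +
        ((loop (scalar .classes) denomProg).steps M₀ + ((setScalar index (lit 0)).steps M₁ +
          (loop (scalar .classes) initProg).steps M₂)) := by
      rw [setup, steps_seq, e₀, steps_seq, e₁, steps_seq, e₂]
      rfl
    rw [hsteps]
    simp only [setupEffort, add_mul, two_mul] at *
    omega

end Algorithm

namespace Instance

variable (I : Instance)

/-! ### The size of the numbers -/

variable {T : ℕ} (σ : Fin T → Fin I.n)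

theorem class_le_inputSize (j : Fin I.ℓ) :
    bits (I.k j) + bits (I.W j).num + bits (I.W j).den + I.k j ≤ I.inputSize σ := by
  have h1 : I.k j ≤ ∑ i : Fin (I.k j), bits (I.init j i).val := by
    simpa using Finset.card_nsmul_le_sum Finset.univ
      (fun i : Fin (I.k j) => bits (I.init j i).val) 1 (fun i _ => Nat.le_add_left _ _)
  have h2 := Finset.single_le_sum (f := fun j : Fin I.ℓ =>
    bits (I.k j) + bits (I.W j).num + bits (I.W j).den + ∑ i : Fin (I.k j), bits (I.init j i).val)
    (fun _ _ => Nat.zero_le _) (Finset.mem_univ j)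
  unfold inputSize
  omega

theorem ℓ_le_inputSize : I.ℓ ≤ I.inputSize σ := by
  have h1 : I.ℓ ≤ ∑ j : Fin I.ℓ, (bits (I.k j) + bits (I.W j).num + bits (I.W j).den +
      ∑ i : Fin (I.k j), bits (I.init j i).val) := by
    simpa using Finset.card_nsmul_le_sum Finset.univ (fun j : Fin I.ℓ => bits (I.k j) +
      bits (I.W j).num + bits (I.W j).den + ∑ i : Fin (I.k j), bits (I.init j i).val) 1
      (fun j _ => by simp only [bits]; omega)
  unfold inputSize
  omega

theorem length_le_inputSize : T ≤ I.inputSize σ := by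
  have h1 : T ≤ ∑ t : Fin T, bits (σ t).val := by
    simpa using Finset.card_nsmul_le_sum Finset.univ (fun t : Fin T => bits (σ t).val) 1
      (fun i _ => Nat.le_add_left _ _)
  unfold inputSize
  omega

theorem denom_le : I.denom ≤ 2 ^ I.inputSize σ := by
  have h1 : I.denom ≤ 2 ^ ∑ j : Fin I.ℓ, Nat.size (I.W j).den := by
    rw [denom, ← Finset.prod_pow_eq_pow_sum]
    exact Finset.prod_le_prod' fun j _ => (Nat.lt_size_self _).le
  refine h1.trans (Nat.pow_le_pow_right two_pos ?_)
  have h2 : ∑ j : Fin I.ℓ, Nat.size (I.W j).den ≤ ∑ j : Fin I.ℓ, (bits (I.k j) +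
      bits (I.W j).num + bits (I.W j).den + ∑ i : Fin (I.k j), bits (I.init j i).val) :=
    Finset.sum_le_sum fun j _ => by simp only [bits]; omega
  unfold inputSize
  omega

theorem augCount_le (j : Fin I.ℓ) : I.augCount j ≤ 2 * I.inputSize σ ^ 2 := by
  have h1 := I.ℓ_le_inputSize σ
  have h2 : I.k j ≤ I.inputSize σ := le_trans (Nat.le_add_left _ _) (I.class_le_inputSize σ j)
  calc 2 * I.ℓ * I.k j ≤ 2 * I.inputSize σ * I.inputSize σ :=
        Nat.mul_le_mul (Nat.mul_le_mul_left _ h1) h2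
    _ = _ := by ring

theorem fits : I.Fits (2 * I.inputSize σ + 1) := by
  have key : ∀ x, bits x ≤ I.inputSize σ → x < 2 ^ I.inputSize σ := fun x hx =>
    Nat.size_le.1 ((Nat.le_succ _).trans hx)
  have hle : 2 ^ I.inputSize σ ≤ 2 ^ (2 * I.inputSize σ + 1) :=
    Nat.pow_le_pow_right two_pos (by omega)
  have hpow : 2 ^ (2 * I.inputSize σ + 1) = 2 * 2 ^ I.inputSize σ * 2 ^ I.inputSize σ := by ring
  have hpos : 0 < 2 ^ I.inputSize σ := Nat.two_pow_pos _
  have hℓ : I.ℓ < 2 ^ I.inputSize σ :=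
    (I.ℓ_le_inputSize σ).trans_lt Nat.lt_two_pow_self
  refine ⟨(key _ ?_).trans_le hle, hℓ.trans_le hle, fun j => ?_, fun j => ?_, ?_⟩
  · unfold inputSize; omega
  · rw [hpow]
    exact Nat.mul_lt_mul'' (Nat.mul_lt_mul_of_pos_left hℓ two_pos)
      (key _ (by have := I.class_le_inputSize σ j; omega))
  · have h1 : (I.W j).num < 2 ^ I.inputSize σ :=
      key _ (by have := I.class_le_inputSize σ j; omega)
    have h2 : I.denom / (I.W j).den ≤ 2 ^ I.inputSize σ :=
      (Nat.div_le_self _ _).trans (I.denom_le σ)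
    calc I.weight j ≤ (I.W j).num * 2 ^ I.inputSize σ := Nat.mul_le_mul_left _ h2
      _ < 2 * 2 ^ I.inputSize σ * 2 ^ I.inputSize σ :=
        Nat.mul_lt_mul_of_pos_right (by omega) hpos
      _ = _ := hpow.symm
  · refine (I.denom_le σ).trans_lt (Nat.pow_lt_pow_right one_lt_two (by omega))

/-! ### The cost in integers -/

variable {I}

/-- Twice the movement cost, multiplied by the common denominator of the weights. -/
def intCost {m : Fin I.ℓ → ℕ} {T : ℕ} (f : Fin (T + 1) → I.Config m) : ℤ :=
  ∑ j, (I.weight j : ℤ) * ∑ s : Fin (m j), ∑ t : Fin T,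
    if f t.succ j s ≠ f t.castSucc j s then 1 else 0

theorem cost_eq {m : Fin I.ℓ → ℕ} {T : ℕ} (f : Fin (T + 1) → I.Config m) :
    I.cost f = intCost f / (2 * I.denom) := by
  have hd : (I.denom : ℝ) ≠ 0 := by exact_mod_cast I.denom_pos.ne'
  have hW : ∀ j, (I.W j : ℝ) = I.weight j / I.denom := by
    intro j
    have hj : ((I.W j).den : ℝ) ≠ 0 := by exact_mod_cast (I.W j).den_pos.ne'
    rw [weight, Nat.cast_mul, Nat.cast_div (I.den_dvd_denom j) hj, NNRat.cast_def]
    field_simp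
  unfold cost intCost
  push_cast
  rw [Finset.sum_div, Finset.mul_sum]
  refine Finset.sum_congr rfl fun j _ => ?_
  rw [hW]
  field_simp

/-- The last step contributes separately to the cost. -/
theorem intCost_succ {m : Fin I.ℓ → ℕ} {T : ℕ} (f : Fin (T + 2) → I.Config m) :
    intCost f = intCost (fun t : Fin (T + 1) => f t.castSucc) + ∑ j, (I.weight j : ℤ) *
      ∑ s : Fin (m j), if f (Fin.last _) j s ≠ f (Fin.last T).castSucc j s then 1 else 0 := by
  unfold intCost
  rw [← Finset.sum_add_distrib]
  refine Finset.sum_congr rfl fun j _ => ?_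
  rw [← mul_add, ← Finset.sum_add_distrib]
  refine congrArg _ (Finset.sum_congr rfl fun s _ => ?_)
  rw [Fin.sum_univ_castSucc]
  rfl

end Instance

/-! ### The competitive ratio -/

namespace Algorithm

open WeightedKServer.Expr WeightedKServer.Prog

/-- The online algorithm; it tosses no coin. -/
def algorithm : OnlineAlgorithm := ⟨setup, serve⟩

variable {I : Instance} {B : ℕ}

theorem setup_flipFree : setup.FlipFree := by
  simp [setup, denomProg, classProg, slotProg, next, FlipFree]

theorem serve_flipFree : serve.FlipFree := by
  simp [serve, serveInit, scanProg, raiseProg, saveProg, flushProg, placeProg, next, FlipFree]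

theorem readConfig_eq {t : ℕ} {M : Mem} (h : Prepared I t B M) (j : Fin I.ℓ)
    (s : Fin (I.augCount j)) : (I.readConfig M j s : ℕ) = (ledger M j).pos s :=
  Nat.mod_eq_of_lt ((h.valid j).pos_lt s)

theorem moves_eq {m : ℕ} {n : ℕ} {s s' : Ledger} {c c' : Fin m → Fin n}
    (h : ∀ i, (c i : ℕ) = s.pos i) (h' : ∀ i, (c' i : ℕ) = s'.pos i) :
    (Ledger.moves m s s' : ℤ) = ∑ i, if c' i ≠ c i then 1 else 0 := by
  rw [Ledger.moves, Finset.card_filter, Finset.sum_range]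
  push_cast
  refine Finset.sum_congr rfl fun i _ => ?_
  simp only [ne_eq, ← h, ← h', Fin.ext_iff]

/-- The state after the requests `σ`: the potential and the cost of the algorithm are bounded by the
cost of each solution `f` of the instance. -/
theorem play_algorithm (hB : I.Fits B) {A : ℕ} (hA : ∀ j, I.augCount j ≤ A) (T : ℕ)
    (hT : T < 2 ^ B) (σ : Fin T → Fin I.n) :
    ∃ (M : Mem) (τ : ℕ) (F : Fin (T + 1) → I.Config I.augCount),
      algorithm.play I T σ = PMF.pure (⟨M, τ⟩, F) ∧ Prepared I T B M ∧
      τ ≤ setupEffort * ((B + 1) * (A + 1) * (I.ℓ + 1)) +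
        T * (serveEffort * ((B + 1) * (I.ℓ + 1))) ∧
      I.IsSolution I.augInit σ F ∧
      (∀ j s, (F (Fin.last T) j s : ℕ) = (ledger M j).pos s) ∧
      ∀ f : Fin (T + 1) → I.Config I.k, I.IsSolution I.init σ f →
        Instance.intCost F + ∑ j : Fin I.ℓ, (ledger M j).potential I.ℓ I.n (I.weight j)
          (fun i => f (Fin.last T) j i) ≤ 4 * I.ℓ ^ 2 * Instance.intCost f := by
  induction T with
  | zero =>
    obtain ⟨h1, h2, h3⟩ := run_setup hB hA
    refine ⟨_, 0 + setup.steps I.inputMem, fun _ => I.augInit, ?_, h1, ?_, ⟨rfl, fun t => t.elim0⟩, fun j s => ?_,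
      fun f hf => ?_⟩
    · rw [OnlineAlgorithm.play, algorithm, exec_eq_pure _ setup_flipFree, PMF.pure_map]
    · simpa using h3
    · rw [(h2 j).pos s s.2]
      simp [Instance.augInit, Instance.inputMem, Nat.mod_lt _ (I.k_pos j)]
    · have h4 : ∀ j : Fin I.ℓ, (ledger (setup.run I.inputMem) j).potential I.ℓ I.n (I.weight j)
          (fun i => f (Fin.last 0) j i) = 0 := by
        intro j
        rw [← (h2 j).potential_eq (ℓ := I.ℓ)]
        congr 1
        funext i
        have : f (Fin.last 0) = I.init := hf.1
        rw [this]
        simp [Instance.inputMem]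
      simp only [h4]
      simp [Instance.intCost]
  | succ T ih =>
    obtain ⟨M, τ, F, h1, h2, h3, h4, h5, h6⟩ := ih (Nat.lt_of_succ_lt hT) fun t => σ t.castSucc
    set p := σ (Fin.last T) with hp
    obtain ⟨h2', l2⟩ := h2.congr (M' := M.write .request 0 0 p)
      (fun a a1 _ _ _ => Mem.write_of_ne a1 _ _ _ _)
      (h2.small.write _ _ _ (p.2.trans hB.n_lt))
    obtain ⟨r1, r2, r3⟩ := run_serve h2' hB hT p (by simp [Mem.write])
    simp only [l2] at r3
    set M' := serve.run (M.write .request 0 0 p) with hM'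
    set F' : Fin (T + 2) → I.Config I.augCount :=
      Fin.snoc (α := fun _ => I.Config I.augCount) F (I.readConfig M') with hF'
    have hlast : F' (Fin.last _) = I.readConfig M' := by simp [hF']
    have hinit : ∀ t : Fin (T + 1), F' t.castSucc = F t := fun t => by simp [hF']
    have hserved : ∃ j : Fin I.ℓ, (ledger M' j).cover ((ledger M' j).cell I.n p) ≠ 0 := by
      rcases r3 with ⟨⟨j, hj⟩, hl⟩ | ⟨D, hl, j, hj⟩
      · exact ⟨j, by rw [hl]; exact hj⟩
      · exact ⟨j, by rw [(hl j).2.2]; exact Ledger.cover_raise hj⟩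
    refine ⟨M', τ + serve.steps (M.write .request 0 0 p), F', ?_, r1, ?_, ⟨?_, fun t => ?_⟩, fun j s => ?_, fun f hf => ?_⟩
    · rw [OnlineAlgorithm.play, h1, PMF.pure_bind, algorithm, exec_eq_pure _ serve_flipFree,
        PMF.pure_map]
    · rw [add_mul T]
      omega
    · exact (hinit 0).trans h4.1
    · refine Fin.lastCases ?_ (fun t => ?_) t
      · obtain ⟨j, hj⟩ := hserved
        obtain ⟨i, hi, hpos⟩ := (r1.valid j).covered p p.2 hj
        refine ⟨j, ⟨i, hi.trans_le (r1.valid j).used_le⟩, Fin.ext ?_⟩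
        rw [Fin.succ_last, hlast, readConfig_eq r1]
        exact hpos
      · rw [Fin.succ_castSucc, hinit]
        exact h4.2 t
    · rw [hlast, readConfig_eq r1]
    · have hf' : I.IsSolution I.init (fun t => σ t.castSucc)
          (fun t : Fin (T + 1) => f t.castSucc) :=
        ⟨hf.1, fun t => by
          have := hf.2 t.castSucc
          rwa [Fin.succ_castSucc] at this⟩
      have ih := h6 _ hf'
      have hmove : ∑ j : Fin I.ℓ, (ledger M j).potential I.ℓ I.n (I.weight j)
            (fun i => f (Fin.last (T + 1)) j i) ≤
          ∑ j : Fin I.ℓ, ((ledger M j).potential I.ℓ I.n (I.weight j)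
            (fun i => f (Fin.last T).castSucc j i) + 4 * I.ℓ ^ 2 * (I.weight j *
              ∑ i, if f (Fin.last (T + 1)) j i ≠ f (Fin.last T).castSucc j i then 1 else 0)) := by
        refine Finset.sum_le_sum fun j _ => ?_
        have := (h2.valid j).potential_le_of_move (ℓ := I.ℓ)
          (Y := fun i => f (Fin.last T).castSucc j i) (Y' := fun i => f (Fin.last (T + 1)) j i)
          (fun i => Fin.is_lt _)
        simpa only [ne_eq, Fin.ext_iff] using this
      have hstep : ∑ j : Fin I.ℓ, ((ledger M' j).potential I.ℓ I.n (I.weight j)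
            (fun i => f (Fin.last (T + 1)) j i) +
            I.weight j * Ledger.moves (I.augCount j) (ledger M j) (ledger M' j)) ≤
          ∑ j : Fin I.ℓ, (ledger M j).potential I.ℓ I.n (I.weight j)
            (fun i => f (Fin.last (T + 1)) j i) := by
        rcases r3 with ⟨-, hl⟩ | ⟨D, hl, -⟩
        · refine Finset.sum_le_sum fun j _ => ?_
          rw [hl]
          simp [Ledger.moves]
        · simp only [(hl _).2.2]
          obtain ⟨j, s, hjs⟩ := hf.2 (Fin.last T)
          exact Ledger.sum_potential_raise_le (L := fun j : Fin I.ℓ => ledger M j) h2.valid p.2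
            (fun j => (hl j).1) (fun j => (hl j).2.1) (fun j i => Fin.is_lt _)
            ⟨j, s, congrArg Fin.val hjs⟩
      have hmoves : ∀ j : Fin I.ℓ,
          (Ledger.moves (I.augCount j) (ledger M j) (ledger M' j) : ℤ) =
          ∑ s, if F' (Fin.last _) j s ≠ F' (Fin.last T).castSucc j s then 1 else 0 := fun j =>
        moves_eq (fun s => by rw [hinit, h5]) (fun s => by rw [hlast, readConfig_eq r1])
      simp only [hmoves, Finset.sum_add_distrib] at hstep
      rw [Finset.sum_add_distrib, ← Finset.mul_sum] at hmove
      rw [Instance.intCost_succ F', Instance.intCost_succ f]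
      have hF : (fun t : Fin (T + 1) => F' t.castSucc) = F := funext hinit
      rw [hF]
      linarith

/-- A polynomial bound for the total time in terms of the input size. -/
noncomputable def timeBound : Polynomial ℕ :=
  Polynomial.C setupEffort * ((2 * Polynomial.X + 1 + 1) * (2 * Polynomial.X ^ 2 + 1) *
    (Polynomial.X + 1)) +
  Polynomial.X * (Polynomial.C serveEffort * ((2 * Polynomial.X + 1 + 1) * (Polynomial.X + 1)))

/-- The outcome of the algorithm: it serves all requests in polynomial time, at a cost of at most
`4 * ℓ ^ 2` times that of each solution of the instance. -/
theorem play_algorithm_inputSize (I : Instance) {T : ℕ} (σ : Fin T → Fin I.n) :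
    ∃ (s : State) (F : Fin (T + 1) → I.Config I.augCount),
      algorithm.play I T σ = PMF.pure (s, F) ∧ I.IsSolution I.augInit σ F ∧
      s.time ≤ timeBound.eval (I.inputSize σ) ∧
      ∀ f : Fin (T + 1) → I.Config I.k, I.IsSolution I.init σ f →
        I.cost F ≤ 4 * I.ℓ ^ 2 * I.cost f := by
  have hN := I.length_le_inputSize σ
  have hℓ := I.ℓ_le_inputSize σ
  obtain ⟨M, τ, F, h1, h2, h3, h4, -, h5⟩ := play_algorithm (I.fits σ) (I.augCount_le σ) T
    (hN.trans_lt (Nat.lt_two_pow_self.trans_le (Nat.pow_le_pow_right two_pos (by omega)))) σ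
  refine ⟨_, F, h1, h4, h3.trans ?_, fun f hf => ?_⟩
  · simp only [timeBound, Polynomial.eval_add, Polynomial.eval_mul, Polynomial.eval_C,
      Polynomial.eval_X, Polynomial.eval_pow, Polynomial.eval_one, Polynomial.eval_ofNat]
    gcongr
  · have hpot : 0 ≤ ∑ j : Fin I.ℓ, (ledger M j).potential I.ℓ I.n (I.weight j)
        (fun i => f (Fin.last T) j i) :=
      Finset.sum_nonneg fun j _ => (h2.valid j).potential_nonneg fun i => Fin.is_lt _
    have hle : (Instance.intCost F : ℝ) ≤ 4 * I.ℓ ^ 2 * Instance.intCost f := by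
      exact_mod_cast (le_add_of_nonneg_right hpot).trans (h5 f hf)
    rw [Instance.cost_eq, Instance.cost_eq, ← mul_div_assoc]
    exact div_le_div_of_nonneg_right hle (by positivity)

/-- As the algorithm tosses no coin, its expected cost is its cost. -/
theorem expectedCost_algorithm_le (I : Instance) {T : ℕ} (σ : Fin T → Fin I.n) :
    algorithm.expectedCost I σ ≤ ENNReal.ofReal (4 * I.ℓ ^ 2 * I.opt σ) := by
  obtain ⟨s, F, h1, -, -, h2⟩ := play_algorithm_inputSize I σ
  obtain ⟨f, hf, hopt⟩ := (I.isLeast_opt σ).1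
  have hcost : algorithm.expectedCost I σ = ENNReal.ofReal (I.cost F) := by
    rw [OnlineAlgorithm.expectedCost, h1, tsum_eq_single ((s, F) : State × _)]
    · simp
    · intro o ho
      simp [PMF.pure_apply, ho]
  rw [hcost, hopt]
  exact ENNReal.ofReal_le_ofReal (h2 f hf)

end Algorithm

theorem Instance.opt_nonneg (I : Instance) {T : ℕ} (σ : Fin T → Fin I.n) : 0 ≤ I.opt σ := by
  obtain ⟨f, -, hopt⟩ := (I.isLeast_opt σ).1
  rw [hopt]
  refine mul_nonneg (by norm_num) (Finset.sum_nonneg fun j _ => mul_nonneg (by positivity) ?_)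
  exact_mod_cast Nat.zero_le _

end WeightedKServer

theorem theorem4 :
    ∃ (A : WeightedKServer.OnlineAlgorithm) (C : ℝ) (p : Polynomial ℕ),
      ∀ (I : WeightedKServer.Instance) (T : ℕ) (σ : Fin T → Fin I.n),
        (∀ o ∈ (A.play I T σ).support,
          I.IsSolution I.augInit σ o.2 ∧ o.1.time ≤ p.eval (I.inputSize σ)) ∧
        A.expectedCost I σ ≤
          ENNReal.ofReal (C * ((I.ℓ : ℝ) ^ 2 * Real.log ((I.ℓ : ℝ) + 1)) * I.opt σ) := by
  refine ⟨WeightedKServer.Algorithm.algorithm, 8, WeightedKServer.Algorithm.timeBound,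
    fun I T σ => ⟨fun o ho => ?_, ?_⟩⟩
  · obtain ⟨s, F, h1, h2, h3, -⟩ := WeightedKServer.Algorithm.play_algorithm_inputSize I σ
    rw [h1, PMF.support_pure, Set.mem_singleton_iff] at ho
    subst ho
    exact ⟨h2, h3⟩
  · refine (WeightedKServer.Algorithm.expectedCost_algorithm_le I σ).trans
      (ENNReal.ofReal_le_ofReal (mul_le_mul_of_nonneg_right ?_ (I.opt_nonneg σ)))
    -- `log (ℓ + 1) ≥ log 2 > 1 / 2`.
    have hℓ : (1 : ℝ) ≤ I.ℓ := by exact_mod_cast I.ℓ_pos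
    have h1 : Real.log 2 ≤ Real.log (I.ℓ + 1) := Real.log_le_log (by norm_num) (by linarith)
    have h2 : (4 : ℝ) ≤ 8 * Real.log (I.ℓ + 1) := by linarith [Real.log_two_gt_d9]
    have := mul_le_mul_of_nonneg_right h2 (sq_nonneg (I.ℓ : ℝ))
    linarith
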